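/- Let $\beta>0$, $\nu\in(0,1)$ and let $\lambda_1,\lambda_2,\dots\ge 0$ be rates. **Fractional nonlinear birth process.** A fractional nonlinear birth process $\mathfrak N^\nu(t)$, $t\ge0$, of order $\nu$ with rates $(\lambda_r)_{r\ge1}$ is a process with values in $\{1,2,\dots\}$, with right-continuous nondecreasing paths with unit jumps (only finitely many in finite time, i.e. there is no explosion), such that $\mathfrak N^\nu(0)=1$ and such that the state probabilities $p_n(t)=\mathbb P(\mathfrak N^\nu(t)=n)$ are locally absolutely continuous on $[0,\infty)$ and satisfy, with $p_0=0$, $$\frac{1}{\Gamma(1-\nu)}\int_0^t\frac{p_n'(s)}{(t-s)^\nu}\,ds=-\lambda_np_n(t)+\lambda_{n-1}p_{n-1}(t),\qquad n\ge1,\ \text{for a.e. } t>0.$$ **Generalized Yule model.** Starting from one initial webpage at time $0$, webpages are created according to a homogeneous Yule process of rate $\beta$: the times during which exactly $k$ webpages exist, $k\ge1$, are independent and exponentially distributed with rate $\beta k$. From the creation of a webpage on, the number of its in-links evolves as a copy of $\mathfrak N^\nu$; the copies belonging to different webpages are independent of each other and of the creation times. For $t>0$ let ${}_t\mathcal N^\nu$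 be the number of in-links at time $t$ of a webpage chosen uniformly at random among those created in $(0,t]$, conditionally on there being at least one. Then, with empty products equal to $1$, for all $t>0$ and $n\ge1$, $$\mathbb P({}_t\mathcal N^\nu=n)=\frac{\beta}{1-e^{-\beta t}}\int_0^te^{-\beta y}\,\mathbb P(\mathfrak N^\nu(y)=n)\,dy =\frac1{1-e^{-\beta t}}\left[\beta^\nu\frac{\prod_{r=1}^{n-1}\lambda_r}{\prod_{r=1}^{n}(\beta^\nu+\lambda_r)}-\beta\int_t^\infty e^{-\beta y}\,\mathbb P(\mathfrak N^\nu(y)=n)\,dy\right].$$ As $t\to\infty$, ${}_t\mathcal N^\nu$ converges in distribution to a random variable $\mathcal N^\nu$ with $$\mathbb P(\mathcal N^\nu=n)=\beta^\nu\frac{\prod_{r=1}^{n-1}\lambda_r}{\prod_{r=1}^{n}(\beta^\nu+\lambda_r)},\qquad n\ge1,$$ and these numbers sum to $1$. The limit in distribution is the same if the webpage is chosen uniformly at random among all webpages present at time $t$, including the initial one. -/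

import Mathlib

open MeasureTheory ProbabilityTheory Set Filter Topology
open scoped NNReal

noncomputable section

/-- The Caputo derivative of order `ν ∈ (0,1)` with base point `0`:
`(1 / Γ(1 - ν)) ∫₀ᵗ f'(s) (t - s)^(-ν) ds`. -/
def caputoDeriv (ν : ℝ) (f : ℝ → ℝ) (t : ℝ) : ℝ :=
  1 / Real.Gamma (1 - ν) * ∫ s in (0 : ℝ)..t, deriv f s / (t - s) ^ ν

/-- The state probability `t ↦ P(X(t) = n)` of an `ℕ`-valued process, as a function of a real
time `t` (it is only used for `t ≥ 0`). -/
def stateProb {Ω : Type*} [MeasurableSpace Ω] (P : Measure Ω) (X : ℝ≥0 → Ω → ℕ) (n : ℕ)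
    (t : ℝ) : ℝ :=
  P.real {ω | X t.toNNReal ω = n}

/-- `X` is a fractional nonlinear birth process of order `ν` with rates `lam 1, lam 2, …` and one
initial progenitor: it starts from `1`, its paths are right-continuous and nondecreasing with unit
jumps, it has finitely many jumps in finite time (its values are natural numbers), and its state
probabilities `p n` are locally absolutely continuous and solve
`d^ν p_n / dt^ν = - lam n * p_n + lam (n - 1) * p_(n - 1)` for `n ≥ 1`, where `p_0 = 0`
and `d^ν / dt^ν` is the Caputo derivative. -/
structure IsFractionalBirthProcess {Ω : Type*} [MeasurableSpace Ω] (ν : ℝ) (lam : ℕ → ℝ)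
    (P : Measure Ω) (X : ℝ≥0 → Ω → ℕ) : Prop where
  measurable : ∀ t, Measurable (X t)
  initial : ∀ ω, X 0 ω = 1
  mono : ∀ ω, Monotone fun t => X t ω
  right_continuous : ∀ ω t, ContinuousWithinAt (fun s => X s ω) (Ici t) t
  unit_jumps : ∀ ω t, 0 < t → ∃ s < t, X t ω ≤ X s ω + 1
  absolutelyContinuous : ∀ n, ∀ t : ℝ, 0 < t →
    AbsolutelyContinuousOnInterval (stateProb P X n) 0 t
  governing_equation : ∀ n, 1 ≤ n → ∀ᵐ t ∂(volume.restrict (Ioi (0 : ℝ))),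
    caputoDeriv ν (stateProb P X n) t
      = - lam n * stateProb P X n t + lam (n - 1) * stateProb P X (n - 1) t

/-- `E k` is the time during which exactly `k + 1` webpages exist. The webpage number `j` is
created at time `E 0 + ⋯ + E (j - 1)`; the initial webpage has number `0` and is created at
time `0`. -/
def creationTime {Ω : Type*} (E : ℕ → Ω → ℝ) (j : ℕ) (ω : Ω) : ℝ :=
  ∑ i ∈ Finset.range j, E i ω

/-- The number of webpages created after time `0` and up to time `t` (that is, of all the webpages
present at time `t` except the initial one). -/
def numNewPages {Ω : Type*} (E : ℕ → Ω → ℝ) (t : ℝ) (ω : Ω) : ℕ :=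
  Set.ncard {j : ℕ | 1 ≤ j ∧ creationTime E j ω ≤ t}

/-- The generalized nonlinear Yule model.
* Webpages appear according to a homogeneous Yule process of rate `β` started from one webpage:
  the holding time `E k` in the state with `k + 1` webpages is exponential of rate `β (k + 1)`,
  and the holding times are independent.
* The numbers of in-links of the webpages are, from their creation on, independent copies
  `X 0, X 1, …` of a fractional nonlinear birth process, independent of the creation of webpages.
* `U` is a uniform random variable on `[0,1]`, independent of everything else, that serves for
  choosing a webpage uniformly at random. -/
structure IsGeneralizedYuleModel {Ω : Type*} [MeasurableSpace Ω] (β ν : ℝ) (lam : ℕ → ℝ)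
    (P : Measure Ω) (E : ℕ → Ω → ℝ) (X : ℕ → ℝ≥0 → Ω → ℕ) (U : Ω → ℝ) : Prop where
  measurable_holding : ∀ k, Measurable (E k)
  holding_law : ∀ k : ℕ, HasLaw (E k) (expMeasure (β * (k + 1))) P
  holding_indep : iIndepFun E P
  links : ∀ j, IsFractionalBirthProcess ν lam P (X j)
  links_copies : ∀ j, IdentDistrib (fun ω s => X j s ω) (fun ω s => X 0 s ω) P P
  links_indep : iIndepFun (fun (j : ℕ) (ω : Ω) (s : ℝ≥0) => X j s ω) P
  links_indep_holding :
    IndepFun (fun (ω : Ω) (k : ℕ) => E k ω) (fun (ω : Ω) (j : ℕ) (s : ℝ≥0) => X j s ω) P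
  measurable_choice : Measurable U
  choice_law : pdf.IsUniform U (Icc (0 : ℝ) 1) P volume
  choice_indep : IndepFun U (fun ω => ((fun k => E k ω : ℕ → ℝ),
    (fun j s => X j s ω : ℕ → ℝ≥0 → ℕ))) P

/-- The number of in-links at time `t` of the webpage number `j`, which must be present at
time `t`. -/
def linksAt {Ω : Type*} (E : ℕ → Ω → ℝ) (X : ℕ → ℝ≥0 → Ω → ℕ) (t : ℝ) (j : ℕ) (ω : Ω) : ℕ :=
  X j (t - creationTime E j ω).toNNReal ω

/-- The number of in-links of a webpage chosen uniformly at random among the `K` webpages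
`1, …, K` created in `(0,t]` (it is meaningful when `K ≥ 1`). -/
def randomPageLinks {Ω : Type*} (E : ℕ → Ω → ℝ) (X : ℕ → ℝ≥0 → Ω → ℕ) (U : Ω → ℝ) (t : ℝ)
    (ω : Ω) : ℕ :=
  linksAt E X t (⌊U ω * numNewPages E t ω⌋₊ + 1) ω

/-- The number of in-links of a webpage chosen uniformly at random among all the `K + 1` webpages
`0, …, K` present at time `t`, including the initial one. -/
def randomAnyPageLinks {Ω : Type*} (E : ℕ → Ω → ℝ) (X : ℕ → ℝ≥0 → Ω → ℕ) (U : Ω → ℝ) (t : ℝ)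
    (ω : Ω) : ℕ :=
  linksAt E X t ⌊U ω * (numNewPages E t ω + 1)⌋₊ ω

/-- The distribution `P(ₜN = n)` of the number of in-links at time `t` of a webpage chosen
uniformly at random among those created in `(0,t]`, given that there is at least one. -/
def randomPageProb {Ω : Type*} [MeasurableSpace Ω] (P : Measure Ω) (E : ℕ → Ω → ℝ)
    (X : ℕ → ℝ≥0 → Ω → ℕ) (U : Ω → ℝ) (t : ℝ) (n : ℕ) : ℝ :=
  (ProbabilityTheory.cond P {ω | 1 ≤ numNewPages E t ω}).real {ω | randomPageLinks E X U t ω = n}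

end

/-! Given that `K ≥ 1` pages were created in `(0,t]`, a uniformly chosen one has age with density `β
e^(-βy) / (1 - e^(-βt))` on `(0,t]`, whatever `K` is. Its links are the birth process observed at
this independent age, which gives the integral formula. As `t → ∞` the age becomes exponential of
rate `β`, so the limit is the law of the process at an independent exponential time, `q n = β ∫
e^(-βy) p_n(y) dy`.

The age law (`sum_lintegral_newPagesEvent`) comes from multiplying the density of the `i+1`-st
creation time by the probability of `K - i` later creations (`K + 1` pages in all); summed over `i`,
the binomial theorem collapses these products (`sum_yuleFun_mul`).

The values `q n` come from the Caputo equation. A Riemann–Liouville integral of order `ν` turns it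
into a convolution equation with kernel `t^(ν-1)`, whose Laplace transform at `β`
(`laplace_of_caputoDeriv`) reads `(β^ν + λ_n) q n = λ_(n-1) q (n-1) + β^ν δ_(n,1)`; induction gives
the product. The `q n` sum to `1` by Tonelli, since the `p_n(y)` do for every `y`.

The initial page is chosen with probability `βt e^(-βt) / (1 - e^(-βt))`, which tends to `0`, so
including it does not change the limit. -/

/-! ### Riemann–Liouville inversion and the Laplace transform of a Caputo equation. -/

/-- The Beta integral `∫ₛᵀ (T - t)^(ν - 1) (t - s)^(-ν) dt`. -/
theorem integral_rpow_mul_rpow_neg {ν : ℝ} (hν0 : 0 < ν) (hν1 : ν < 1) {s T : ℝ} (h : s < T) :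
    ∫ t in s..T, (T - t) ^ (ν - 1) * (t - s) ^ (-ν) = Real.Gamma ν * Real.Gamma (1 - ν) := by
  have ha : 0 < T - s := sub_pos.2 h
  have h1 := Complex.betaIntegral_scaled ((1 - ν : ℝ) : ℂ) (ν : ℂ) ha
  have h2 := Complex.Gamma_mul_Gamma_eq_betaIntegral (s := ((1 - ν : ℝ) : ℂ)) (t := (ν : ℂ))
    (by simpa using hν1) (by simpa using hν0)
  have h3 : ((1 - ν : ℝ) : ℂ) + (ν : ℂ) = 1 := by push_cast; ring
  rw [h3] at h1 h2
  simp only [sub_self, Complex.cpow_zero, one_mul, Complex.Gamma_one] at h1 h2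
  rw [← h2] at h1
  have h4 : ∫ x in (0 : ℝ)..(T - s), (T - s - x) ^ (ν - 1) * x ^ (-ν)
      = Real.Gamma ν * Real.Gamma (1 - ν) := by
    apply Complex.ofReal_injective
    rw [← intervalIntegral.integral_ofReal, Complex.ofReal_mul, ← Complex.Gamma_ofReal,
      ← Complex.Gamma_ofReal, mul_comm (Complex.Gamma _), ← h1]
    apply intervalIntegral.integral_congr
    intro x hx
    rw [uIcc_of_le ha.le] at hx
    simp only [Complex.ofReal_mul]
    rw [Complex.ofReal_cpow hx.1, Complex.ofReal_cpow (sub_nonneg.2 hx.2), mul_comm]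
    push_cast
    ring_nf
  rw [← h4, ← sub_self s, ← intervalIntegral.integral_comp_sub_right
    (fun x => (T - s - x) ^ (ν - 1) * x ^ (-ν)) s]
  simp

/-- The Bochner integral of a non-integrable function is `0` by convention, so the nonzero Beta
value forces integrability. -/
theorem intervalIntegrable_rpow_mul_rpow_neg {ν : ℝ} (hν0 : 0 < ν) (hν1 : ν < 1) {s T : ℝ}
    (h : s < T) :
    IntervalIntegrable (fun t => (T - t) ^ (ν - 1) * (t - s) ^ (-ν)) volume s T := by
  apply intervalIntegral.intervalIntegrable_of_integral_ne_zero
  rw [integral_rpow_mul_rpow_neg hν0 hν1 h]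
  exact (mul_pos (Real.Gamma_pos_of_pos hν0) (Real.Gamma_pos_of_pos (by linarith))).ne'

/-- The Riemann–Liouville integral of order `ν` inverts the one of order `1 - ν` up to an
integration. -/
theorem integral_rpow_mul_integral_div_rpow {ν : ℝ} (hν0 : 0 < ν) (hν1 : ν < 1) {T : ℝ}
    (hT : 0 ≤ T) {f : ℝ → ℝ} (hf : IntervalIntegrable f volume 0 T) :
    ∫ t in (0 : ℝ)..T, (T - t) ^ (ν - 1) * ∫ s in (0 : ℝ)..t, f s / (t - s) ^ ν
      = Real.Gamma ν * Real.Gamma (1 - ν) * ∫ s in (0 : ℝ)..T, f s := by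
  set μ := volume.restrict (Ioo (0 : ℝ) T) with hμ
  have hfi : Integrable f μ := by
    rw [intervalIntegrable_iff_integrableOn_Ioo_of_le hT] at hf
    exact hf
  -- The kernel is extended by zero off the triangle `s < t`, so that Fubini applies on the square.
  let k : ℝ → ℝ → ℝ := fun t s => (Ioi s).indicator (fun t => (T - t) ^ (ν - 1) * (t - s) ^ (-ν)) t
  have hk0 : ∀ s ∈ Ioo 0 T, Integrable (fun t => k t s) μ ∧
      ∫ t, k t s ∂μ = Real.Gamma ν * Real.Gamma (1 - ν) := by
    intro s hs
    have e : Ioo 0 T ∩ Ioi s = Ioo s T := by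
      ext t; simp only [mem_inter_iff, mem_Ioo, mem_Ioi]
      constructor
      · rintro ⟨h1, h2⟩; exact ⟨h2, h1.2⟩
      · rintro ⟨h1, h2⟩; exact ⟨⟨hs.1.trans h1, h2⟩, h1⟩
    constructor
    · rw [integrable_indicator_iff measurableSet_Ioi, IntegrableOn, hμ,
        Measure.restrict_restrict measurableSet_Ioi, inter_comm, e]
      have := intervalIntegrable_rpow_mul_rpow_neg hν0 hν1 hs.2
      rwa [intervalIntegrable_iff_integrableOn_Ioo_of_le hs.2.le] at this
    · rw [integral_indicator measurableSet_Ioi, hμ,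
        Measure.restrict_restrict measurableSet_Ioi, inter_comm, e,
        ← integral_rpow_mul_rpow_neg hν0 hν1 hs.2, intervalIntegral.integral_of_le hs.2.le,
        integral_Ioc_eq_integral_Ioo]
  have hkm : Measurable (fun p : ℝ × ℝ => k p.1 p.2) := by
    have : (fun p : ℝ × ℝ => k p.1 p.2) = {p : ℝ × ℝ | p.2 < p.1}.indicator
        (fun p => (T - p.1) ^ (ν - 1) * (p.1 - p.2) ^ (-ν)) := by
      ext p; simp [k, indicator]
    rw [this]
    exact Measurable.indicator (by fun_prop) (measurableSet_lt measurable_snd measurable_fst)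
  have hknn : ∀ s, ∀ t ∈ Ioo 0 T, 0 ≤ k t s := by
    intro s t ht
    apply indicator_apply_nonneg
    intro hs
    have := Real.rpow_nonneg (sub_nonneg.2 ht.2.le) (ν - 1)
    have := Real.rpow_nonneg (sub_nonneg.2 (le_of_lt (mem_Ioi.1 hs))) (-ν)
    positivity
  have hmem : ∀ᵐ t ∂μ, t ∈ Ioo 0 T := ae_restrict_mem measurableSet_Ioo
  have hF : Integrable (fun p : ℝ × ℝ => k p.1 p.2 * f p.2) (μ.prod μ) := by
    have hsm : AEStronglyMeasurable (fun p : ℝ × ℝ => k p.1 p.2 * f p.2) (μ.prod μ) :=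
      hkm.aestronglyMeasurable.mul hfi.1.comp_snd
    rw [integrable_prod_iff' hsm]
    constructor
    · filter_upwards [hmem] with s hs
      exact (hk0 s hs).1.mul_const _
    -- Integrated in `t` first, the nonnegative kernel gives the same constant for every `s`, so
    -- absolute integrability reduces to that of `f`.
    · apply (hfi.norm.const_mul (Real.Gamma ν * Real.Gamma (1 - ν))).congr
      filter_upwards [hmem] with s hs
      simp only [norm_mul]
      rw [integral_mul_const, ← (hk0 s hs).2]
      congr 1
      apply integral_congr_ae
      filter_upwards [hmem] with t ht
      rw [Real.norm_of_nonneg (hknn s t ht)]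
  have h1 := integral_integral_swap (f := fun t s => k t s * f s) hF
  rw [intervalIntegral.integral_of_le hT, integral_Ioc_eq_integral_Ioo,
    intervalIntegral.integral_of_le hT, integral_Ioc_eq_integral_Ioo, ← integral_const_mul]
  trans ∫ t, ∫ s, k t s * f s ∂μ ∂μ
  · apply integral_congr_ae
    filter_upwards [hmem] with t ht
    have e : Ioo 0 T ∩ Iio t = Ioo 0 t := by
      ext s; simp only [mem_inter_iff, mem_Ioo, mem_Iio]
      constructor
      · rintro ⟨h1, h2⟩; exact ⟨h1.1, h2⟩
      · rintro ⟨h1, h2⟩; exact ⟨⟨h1, h2.trans ht.2⟩, h2⟩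
    rw [intervalIntegral.integral_of_le ht.1.le, integral_Ioc_eq_integral_Ioo,
      ← integral_const_mul, ← e, inter_comm, ← Measure.restrict_restrict measurableSet_Iio,
      ← integral_indicator measurableSet_Iio]
    apply integral_congr_ae
    filter_upwards with s
    by_cases hs : s < t
    · simp only [k, indicator, mem_Iio, mem_Ioi, hs, if_true, Real.rpow_neg (sub_pos.2 hs).le]
      ring
    · simp [k, indicator, hs]
  · rw [h1]
    apply integral_congr_ae
    filter_upwards [hmem] with s hs
    rw [integral_mul_const, (hk0 s hs).2]

/-- A solution of a Caputo equation of order `ν` is a Riemann–Liouville integral of order `ν` of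
the right-hand side. -/
theorem sub_eq_integral_of_caputoDeriv {ν : ℝ} (hν0 : 0 < ν) (hν1 : ν < 1) {p h : ℝ → ℝ}
    {T : ℝ} (hT : 0 ≤ T) (hp : AbsolutelyContinuousOnInterval p 0 T)
    (heq : ∀ᵐ t ∂(volume.restrict (Ioi (0 : ℝ))), caputoDeriv ν p t = h t) :
    ∫ t in (0 : ℝ)..T, h t * (T - t) ^ (ν - 1) = Real.Gamma ν * (p T - p 0) := by
  have hG : Real.Gamma (1 - ν) ≠ 0 := (Real.Gamma_pos_of_pos (by linarith)).ne'
  have h1 := integral_rpow_mul_integral_div_rpow hν0 hν1 hT hp.intervalIntegrable_deriv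
  rw [hp.integral_deriv_eq_sub] at h1
  have h2 : ∫ t in (0 : ℝ)..T, h t * (T - t) ^ (ν - 1) = ∫ t in (0 : ℝ)..T,
      1 / Real.Gamma (1 - ν) * ((T - t) ^ (ν - 1) * ∫ s in (0 : ℝ)..t, deriv p s / (t - s) ^ ν) := by
    rw [intervalIntegral.integral_of_le hT, intervalIntegral.integral_of_le hT]
    apply integral_congr_ae
    filter_upwards [ae_restrict_of_ae_restrict_of_subset Ioc_subset_Ioi_self heq] with t ht
    rw [← ht, caputoDeriv]
    ring
  rw [h2, intervalIntegral.integral_const_mul, h1]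
  field_simp

theorem integrableOn_exp_neg_mul {β : ℝ} (hβ : 0 < β) :
    IntegrableOn (fun t => Real.exp (-(β * t))) (Ioi 0) := by
  simpa [neg_mul] using integrableOn_exp_mul_Ioi (neg_lt_zero.2 hβ) 0

theorem integrableOn_exp_neg_mul_mul {β C : ℝ} (hβ : 0 < β) {h : ℝ → ℝ} (hm : Measurable h)
    (hC : ∀ t, |h t| ≤ C) : IntegrableOn (fun t => Real.exp (-(β * t)) * h t) (Ioi 0) :=
  (integrableOn_exp_neg_mul hβ).mul_bdd (c := C) hm.aestronglyMeasurable
    (Eventually.of_forall fun t => by simpa using hC t)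

/-- The Laplace transform of a solution of a Caputo equation with bounded data. -/
theorem laplace_of_caputoDeriv {ν β C : ℝ} (hν0 : 0 < ν) (hν1 : ν < 1) (hβ : 0 < β)
    {p h : ℝ → ℝ} (hp : ∀ t : ℝ, 0 < t → AbsolutelyContinuousOnInterval p 0 t)
    (heq : ∀ᵐ t ∂(volume.restrict (Ioi (0 : ℝ))), caputoDeriv ν p t = h t)
    (hm : Measurable h) (hC : ∀ t, |h t| ≤ C)
    (hpi : IntegrableOn (fun t => Real.exp (-(β * t)) * p t) (Ioi 0)) :
    β * ∫ t in Ioi (0 : ℝ), Real.exp (-(β * t)) * h t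
      = β ^ ν * (β * (∫ t in Ioi (0 : ℝ), Real.exp (-(β * t)) * p t) - p 0) := by
  have hg0 : ∫ t in Ioi (0 : ℝ), Real.exp (-(β * t)) * t ^ (ν - 1)
      = (1 / β) ^ ν * Real.Gamma ν := by
    rw [← Real.integral_rpow_mul_exp_neg_mul_Ioi hν0 hβ]
    simp_rw [mul_comm]
  have hΓ := Real.Gamma_pos_of_pos hν0
  have hgi : IntegrableOn (fun t => Real.exp (-(β * t)) * t ^ (ν - 1)) (Ioi 0) := by
    apply Integrable.of_integral_ne_zero
    rw [hg0]; positivity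
  -- Only the bounded `h` and the kernel are transformed; `p'` is merely locally integrable, so its
  -- Laplace integral need not exist.
  have h1 := integral_posConvolution (integrableOn_exp_neg_mul_mul hβ hm hC) hgi
    (ContinuousLinearMap.mul ℝ ℝ)
  simp only [ContinuousLinearMap.mul_apply'] at h1
  rw [hg0] at h1
  have h2 : ∫ x in Ioi (0 : ℝ), ∫ t in (0 : ℝ)..x, Real.exp (-(β * t)) * h t *
      (Real.exp (-(β * (x - t))) * (x - t) ^ (ν - 1))
      = ∫ x in Ioi (0 : ℝ), (Real.Gamma ν * (Real.exp (-(β * x)) * p x)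
        - Real.Gamma ν * p 0 * Real.exp (-(β * x))) := by
    apply setIntegral_congr_fun measurableSet_Ioi
    intro x hx
    have := sub_eq_integral_of_caputoDeriv hν0 hν1 (le_of_lt hx) (hp x hx) heq
    simp only
    trans Real.exp (-(β * x)) * ∫ t in (0 : ℝ)..x, h t * (x - t) ^ (ν - 1)
    · rw [← intervalIntegral.integral_const_mul]
      apply intervalIntegral.integral_congr
      intro t _
      have e : Real.exp (-(β * x)) = Real.exp (-(β * t)) * Real.exp (-(β * (x - t))) := by
        rw [← Real.exp_add]; ring_nf
      simp only [e]; ring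
    · rw [this]; ring
  have h3 : ∫ t in Ioi (0 : ℝ), Real.exp (-(β * t)) = 1 / β := by
    have := integral_exp_mul_Ioi (neg_lt_zero.2 hβ) 0
    simpa [neg_mul] using this
  rw [h2, integral_sub (hpi.const_mul _) ((integrableOn_exp_neg_mul hβ).const_mul _),
    integral_const_mul, integral_const_mul, h3] at h1
  have hb : (1 / β) ^ ν = (β ^ ν)⁻¹ := by rw [one_div, Real.inv_rpow hβ.le]
  have hbp : 0 < β ^ ν := Real.rpow_pos_of_pos hβ ν
  rw [hb] at h1
  set A := ∫ t in Ioi (0 : ℝ), Real.exp (-(β * t)) * h t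
  set B := ∫ t in Ioi (0 : ℝ), Real.exp (-(β * t)) * p t
  have h4 : Real.Gamma ν * (A * (β ^ ν)⁻¹) = Real.Gamma ν * (B - p 0 * (1 / β)) := by
    rw [mul_sub, ← mul_assoc, ← mul_assoc, h1]; ring
  have h5 := mul_left_cancel₀ hΓ.ne' h4
  field_simp at h5
  linarith

/-! ### State probabilities at an independent exponential time. -/

section process

variable {Ω : Type*} [MeasurableSpace Ω] {P : Measure Ω} {ν : ℝ} {lam : ℕ → ℝ}
  {X : ℝ≥0 → Ω → ℕ}

theorem stateProb_nonneg (n : ℕ) (t : ℝ) : 0 ≤ stateProb P X n t := measureReal_nonneg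

theorem stateProb_le_one [IsProbabilityMeasure P] (n : ℕ) (t : ℝ) : stateProb P X n t ≤ 1 :=
  measureReal_le_one

theorem abs_stateProb_le_one [IsProbabilityMeasure P] (n : ℕ) (t : ℝ) :
    |stateProb P X n t| ≤ 1 := by
  rw [abs_of_nonneg (stateProb_nonneg n t)]
  exact stateProb_le_one n t

theorem ofReal_stateProb [IsProbabilityMeasure P] (n : ℕ) (t : ℝ) :
    ENNReal.ofReal (stateProb P X n t) = P {ω | X t.toNNReal ω = n} :=
  ofReal_measureReal

theorem mul_integral_stateProb_nonneg {β : ℝ} (hβ : 0 < β) (n : ℕ) (s : Set ℝ) :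
    0 ≤ β * ∫ y in s, Real.exp (-(β * y)) * stateProb P X n y :=
  mul_nonneg hβ.le (integral_nonneg fun y => mul_nonneg (Real.exp_pos _).le (stateProb_nonneg n y))

namespace IsFractionalBirthProcess

theorem measurableSet_eq (hX : IsFractionalBirthProcess ν lam P X) (n : ℕ) (t : ℝ≥0) :
    MeasurableSet {ω | X t ω = n} :=
  hX.measurable t (measurableSet_singleton n)

theorem one_le (hX : IsFractionalBirthProcess ν lam P X) (t : ℝ≥0) (ω : Ω) : 1 ≤ X t ω := by
  have := hX.mono ω (zero_le : (0 : ℝ≥0) ≤ t)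
  simpa [hX.initial ω] using this

theorem stateProb_zero (hX : IsFractionalBirthProcess ν lam P X) (t : ℝ) :
    stateProb P X 0 t = 0 := by
  have : {ω | X t.toNNReal ω = 0} = ∅ := by
    ext ω
    have := hX.one_le t.toNNReal ω
    simp; omega
  simp [stateProb, this]

theorem stateProb_at_zero [IsProbabilityMeasure P] (hX : IsFractionalBirthProcess ν lam P X)
    (n : ℕ) : stateProb P X n 0 = if n = 1 then 1 else 0 := by
  simp only [stateProb, Real.toNNReal_zero, hX.initial]
  split_ifs with h
  · simp [h]
  · simp [Ne.symm h]

theorem continuous_stateProb (hX : IsFractionalBirthProcess ν lam P X) (n : ℕ) :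
    Continuous (stateProb P X n) := by
  have h1 : ContinuousOn (stateProb P X n) (Ici 0) := by
    intro t ht
    have h0 : (0 : ℝ) < t + 1 := by have := mem_Ici.1 ht; linarith
    have h2 := (hX.absolutelyContinuous n (t + 1) h0).continuousOn
    rw [uIcc_of_le h0.le] at h2
    have h3 := h2 t ⟨ht, by linarith⟩
    have h4 : Icc 0 (t + 1) ∈ 𝓝[Ici 0] t := by
      rw [← Ici_inter_Iic]
      exact inter_mem self_mem_nhdsWithin (mem_nhdsWithin_of_mem_nhds (Iic_mem_nhds (by linarith)))
    exact h3.mono_of_mem_nhdsWithin h4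
  -- At negative times `toNNReal` freezes the function at its value at `0`.
  have h2 : stateProb P X n = stateProb P X n ∘ fun t => max t 0 := by
    ext t
    simp [stateProb, Real.toNNReal]
  rw [h2]
  exact h1.comp_continuous (by fun_prop) (fun t => mem_Ici.2 (le_max_right _ _))

/-- No mass escapes because the process takes values in `ℕ`: this is the absence of explosion. -/
theorem tsum_ofReal_stateProb [IsProbabilityMeasure P] (hX : IsFractionalBirthProcess ν lam P X)
    (t : ℝ) : ∑' n, ENNReal.ofReal (stateProb P X n t) = 1 := by
  simp_rw [ofReal_stateProb]
  rw [← measure_iUnion _ (fun n => hX.measurableSet_eq n _)]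
  · have : ⋃ n, {ω | X t.toNNReal ω = n} = univ := by
      ext ω; simp
    rw [this, measure_univ]
  · intro i j hij
    exact disjoint_left.2 fun ω (h1 : _ = i) (h2 : _ = j) => hij (h1.symm.trans h2)

theorem integrableOn_exp_mul_stateProb [IsProbabilityMeasure P]
    (hX : IsFractionalBirthProcess ν lam P X) {β : ℝ} (hβ : 0 < β) (n : ℕ) :
    IntegrableOn (fun t => Real.exp (-(β * t)) * stateProb P X n t) (Ioi 0) :=
  integrableOn_exp_neg_mul_mul hβ (hX.continuous_stateProb n).measurable (abs_stateProb_le_one n)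

/-- The right-hand side of the governing equation is bounded because probabilities are; the last
term carries the initial value `p_n(0)`. -/
theorem laplace_recurrence [IsProbabilityMeasure P]
    (hX : IsFractionalBirthProcess ν lam P X) {β : ℝ} (hν0 : 0 < ν) (hν1 : ν < 1) (hβ : 0 < β)
    {n : ℕ} (hn : 1 ≤ n) :
    (β ^ ν + lam n) * (β * ∫ t in Ioi (0 : ℝ), Real.exp (-(β * t)) * stateProb P X n t)
      = lam (n - 1) * (β * ∫ t in Ioi (0 : ℝ), Real.exp (-(β * t)) * stateProb P X (n - 1) t)
        + β ^ ν * (if n = 1 then 1 else 0) := by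
  have hm := fun i => (hX.continuous_stateProb i).measurable
  have h := laplace_of_caputoDeriv (C := |lam n| + |lam (n - 1)|) hν0 hν1 hβ
    (hX.absolutelyContinuous n) (hX.governing_equation n hn)
    (((hm n).const_mul _).add ((hm (n - 1)).const_mul _)) (fun t => by
      refine (abs_add_le _ _).trans (add_le_add ?_ ?_)
      · rw [abs_mul, abs_neg]
        exact mul_le_of_le_one_right (abs_nonneg _) (abs_stateProb_le_one n t)
      · rw [abs_mul]
        exact mul_le_of_le_one_right (abs_nonneg _) (abs_stateProb_le_one (n - 1) t))
    (hX.integrableOn_exp_mul_stateProb hβ n)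
  rw [hX.stateProb_at_zero] at h
  have h2 : ∫ t in Ioi (0 : ℝ), Real.exp (-(β * t)) *
      (-lam n * stateProb P X n t + lam (n - 1) * stateProb P X (n - 1) t)
      = -lam n * (∫ t in Ioi (0 : ℝ), Real.exp (-(β * t)) * stateProb P X n t)
        + lam (n - 1) * ∫ t in Ioi (0 : ℝ), Real.exp (-(β * t)) * stateProb P X (n - 1) t := by
    rw [← integral_const_mul, ← integral_const_mul, ← integral_add
      ((hX.integrableOn_exp_mul_stateProb hβ n).const_mul _)
      ((hX.integrableOn_exp_mul_stateProb hβ (n - 1)).const_mul _)]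
    congr 1 with t
    ring
  rw [h2] at h
  linear_combination -h

/-- The state probabilities at an independent exponential time of rate `β`. -/
theorem laplace_stateProb [IsProbabilityMeasure P]
    (hX : IsFractionalBirthProcess ν lam P X) {β : ℝ} (hν0 : 0 < ν) (hν1 : ν < 1) (hβ : 0 < β)
    (hlam : ∀ r, 1 ≤ r → 0 ≤ lam r) {n : ℕ} (hn : 1 ≤ n) :
    β * ∫ t in Ioi (0 : ℝ), Real.exp (-(β * t)) * stateProb P X n t
      = β ^ ν * ((∏ r ∈ Finset.Ico 1 n, lam r) / ∏ r ∈ Finset.Icc 1 n, (β ^ ν + lam r)) := by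
  have hb : 0 < β ^ ν := Real.rpow_pos_of_pos hβ ν
  induction n, hn using Nat.le_induction with
  | base =>
    have h := hX.laplace_recurrence hν0 hν1 hβ le_rfl
    have := hlam 1 le_rfl
    have h1 : β ^ ν + lam 1 ≠ 0 := by positivity
    -- Here `lam 0` appears, with no assumption on its value; it is multiplied by `p_0 = 0`.
    simp only [le_refl, tsub_eq_zero_of_le, hX.stateProb_zero, mul_zero, integral_zero, zero_add,
      if_true, mul_one] at h
    simp only [Finset.Ico_self, Finset.prod_empty, Finset.Icc_self, Finset.prod_singleton]
    field_simp
    linarith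
  | succ n hn ih =>
    have h := hX.laplace_recurrence hν0 hν1 hβ (n := n + 1) (by omega)
    have := hlam (n + 1) (by omega)
    have h1 : β ^ ν + lam (n + 1) ≠ 0 := by positivity
    have h2 : ∏ r ∈ Finset.Icc 1 n, (β ^ ν + lam r) ≠ 0 := by
      refine Finset.prod_ne_zero_iff.2 fun r hr => ?_
      have := hlam r (Finset.mem_Icc.1 hr).1
      positivity
    rw [Nat.add_sub_cancel, if_neg (by omega), ih, mul_zero, add_zero] at h
    rw [Finset.prod_Ico_succ_top hn, Finset.prod_Icc_succ_top (by omega)]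
    apply mul_left_cancel₀ h1
    rw [h]
    field_simp

theorem lintegral_exp_mul_stateProb [IsProbabilityMeasure P]
    (hX : IsFractionalBirthProcess ν lam P X) {β : ℝ} (hβ : 0 < β) (n : ℕ) {s : Set ℝ}
    (hs : s ⊆ Ioi 0) :
    ∫⁻ y in s, ENNReal.ofReal (β * Real.exp (-(β * y))) * ENNReal.ofReal (stateProb P X n y)
      = ENNReal.ofReal (β * ∫ y in s, Real.exp (-(β * y)) * stateProb P X n y) := by
  rw [← integral_const_mul, ofReal_integral_eq_lintegral_ofReal]
  · congr 1 with y
    rw [← ENNReal.ofReal_mul (by positivity), mul_assoc]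
  · exact ((hX.integrableOn_exp_mul_stateProb hβ n).mono_set hs).const_mul _
  · filter_upwards with y
    have := stateProb_nonneg (P := P) (X := X) n y
    simp only [Pi.zero_apply]
    positivity

/-- The law of the process at an independent exponential time of rate `β`. -/
theorem exists_pmf_laplace [IsProbabilityMeasure P]
    (hX : IsFractionalBirthProcess ν lam P X) {β : ℝ} (hβ : 0 < β) :
    ∃ q : PMF ℕ, ∀ n, (q n).toReal
      = β * ∫ t in Ioi (0 : ℝ), Real.exp (-(β * t)) * stateProb P X n t := by
  refine ⟨⟨fun n => ENNReal.ofReal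
    (β * ∫ t in Ioi (0 : ℝ), Real.exp (-(β * t)) * stateProb P X n t), ?_⟩, fun n => ?_⟩
  · rw [ENNReal.summable.hasSum_iff]
    simp_rw [← hX.lintegral_exp_mul_stateProb hβ _ subset_rfl]
    have hm := fun n => (hX.continuous_stateProb n).measurable
    rw [← lintegral_tsum (fun n => Measurable.aemeasurable (by fun_prop))]
    simp_rw [ENNReal.tsum_mul_left, hX.tsum_ofReal_stateProb, mul_one]
    rw [← lintegral_exponentialPDF_eq_one hβ, ← lintegral_indicator measurableSet_Ioi]
    apply lintegral_congr_ae
    -- The exponential density lives on `[0,∞)`, the integral on `(0,∞)`; the point `0` is null.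
    filter_upwards [compl_mem_ae_iff.2 (measure_singleton (0 : ℝ))] with y hy
    rw [exponentialPDF_eq]
    have hy0 : y ≠ 0 := hy
    by_cases h : 0 < y
    · simp [indicator, h, h.le]
    · have : ¬ 0 ≤ y := fun h' => h (lt_of_le_of_ne h' (Ne.symm hy0))
      simp [indicator, h, this]
  · exact ENNReal.toReal_ofReal (mul_integral_stateProb_nonneg hβ n _)

end IsFractionalBirthProcess

end process

/-! ### Birth times and population size of a Yule process. -/

/-- The function `u ↦ e^(-β (j + 1) u) (1 - e^(-β u))^m` on `[0,∞)`, extended by `0`. Up to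
constants, it is the probability that a Yule process with `j + 1` initial individuals has `m` new
ones at time `u`, and the density of the birth time of the new individual number `m + 1`. -/
noncomputable def yuleFun (β : ℝ) (j m : ℕ) (u : ℝ) : ENNReal :=
  if 0 ≤ u then
    ENNReal.ofReal (Real.exp (-(β * (j + 1) * u)) * (1 - Real.exp (-(β * u))) ^ m) else 0

theorem measurable_yuleFun (β : ℝ) (j m : ℕ) : Measurable (yuleFun β j m) :=
  Measurable.ite measurableSet_Ici (by fun_prop) measurable_const

theorem measurable_yuleFun_sub (β : ℝ) (j m : ℕ) (u : ℝ) :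
    Measurable fun s => yuleFun β j m (u - s) :=
  (measurable_yuleFun β j m).comp (measurable_const.sub measurable_id)

theorem one_sub_exp_neg_nonneg {β u : ℝ} (hβ : 0 ≤ β) (hu : 0 ≤ u) :
    0 ≤ 1 - Real.exp (-(β * u)) := by
  have : 0 ≤ β * u := by positivity
  simp [this]

/-- In `s` the integrand is a constant times `(e^(βs) - 1)^m e^(βs)`, the derivative of a power of
`e^(βs) - 1`. -/
theorem integral_yule (β : ℝ) (j m : ℕ) (u : ℝ) :
    ∫ s in (0 : ℝ)..u, ((m + 1 : ℝ) * β) * (Real.exp (-(β * (j + 1) * s))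
      * (1 - Real.exp (-(β * s))) ^ m * Real.exp (-(β * ((j + m + 1 : ℕ) + 1) * (u - s))))
      = Real.exp (-(β * (j + 1) * u)) * (1 - Real.exp (-(β * u))) ^ (m + 1) := by
  have hd : ∀ s ∈ uIcc 0 u, HasDerivAt (fun s => Real.exp (-(β * (j + 1 + (m + 1)) * u))
      * (Real.exp (β * s) - 1) ^ (m + 1))
      (((m + 1 : ℝ) * β) * (Real.exp (-(β * (j + 1) * s))
      * (1 - Real.exp (-(β * s))) ^ m * Real.exp (-(β * ((j + m + 1 : ℕ) + 1) * (u - s))))) s := by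
    intro s _
    have h1 : HasDerivAt (fun s => Real.exp (β * s) - 1) (Real.exp (β * s) * (β * 1)) s :=
      (((hasDerivAt_id s).const_mul β).exp).sub_const 1
    refine ((h1.pow (m + 1)).const_mul
      (Real.exp (-(β * (j + 1 + (m + 1)) * u)))).congr_deriv ?_
    have h2 : Real.exp (β * s) - 1 = Real.exp (β * s) * (1 - Real.exp (-(β * s))) := by
      rw [mul_sub, ← Real.exp_add]; simp
    have h3 : Real.exp (-(β * (j + 1) * s)) * Real.exp (-(β * ((j + m + 1 : ℕ) + 1) * (u - s)))
        = Real.exp (-(β * (j + 1 + (m + 1)) * u)) * (Real.exp (β * s) ^ m * Real.exp (β * s)) := by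
      rw [← pow_succ, ← Real.exp_nat_mul, ← Real.exp_add, ← Real.exp_add]
      congr 1
      push_cast
      ring
    rw [Nat.add_sub_cancel, h2, mul_pow]
    push_cast at h3 ⊢
    linear_combination (-(m + 1 : ℝ) * β * (1 - Real.exp (-(β * s))) ^ m) * h3
  rw [intervalIntegral.integral_eq_sub_of_hasDerivAt hd
    (Continuous.intervalIntegrable (by fun_prop) _ _)]
  have h2 : Real.exp (β * u) - 1 = Real.exp (β * u) * (1 - Real.exp (-(β * u))) := by
    rw [mul_sub, ← Real.exp_add]; simp
  rw [h2, mul_pow, ← mul_assoc, ← Real.exp_nat_mul, ← Real.exp_add]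
  simp only [mul_zero, Real.exp_zero, sub_self, ne_eq, Nat.add_eq_zero_iff, one_ne_zero, and_false,
    not_false_eq_true, zero_pow, sub_zero]
  congr 2
  push_cast
  ring

/-- The factor `yuleFun β (j + m + 1) 0` is both the tail of the next holding time and, up to its
rate, its density. Hence the identity yields both the law of the next birth time and that of the
population size. -/
theorem lintegral_yuleFun_mul {β : ℝ} (hβ : 0 < β) (j m : ℕ) (u : ℝ) :
    ENNReal.ofReal ((m + 1 : ℝ) * β) *
      ∫⁻ s, yuleFun β j m s * yuleFun β (j + m + 1) 0 (u - s) = yuleFun β j (m + 1) u := by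
  by_cases hu : 0 ≤ u
  · have h1 : ∀ s, yuleFun β j m s * yuleFun β (j + m + 1) 0 (u - s) = (Icc 0 u).indicator
        (fun s => ENNReal.ofReal (Real.exp (-(β * (j + 1) * s)) * (1 - Real.exp (-(β * s))) ^ m
          * Real.exp (-(β * ((j + m + 1 : ℕ) + 1) * (u - s))))) s := by
      intro s
      by_cases h0 : 0 ≤ s
      · by_cases h2 : s ≤ u
        · have := one_sub_exp_neg_nonneg hβ.le h0
          rw [indicator_of_mem (show s ∈ Icc 0 u from ⟨h0, h2⟩), yuleFun, yuleFun, if_pos h0,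
            if_pos (sub_nonneg.2 h2), ← ENNReal.ofReal_mul (by positivity), pow_zero, mul_one]
        · rw [indicator_of_notMem (fun h => h2 h.2), yuleFun, yuleFun,
            if_neg (fun h => h2 (sub_nonneg.1 h)), mul_zero]
      · rw [indicator_of_notMem (fun h => h0 h.1), yuleFun, if_neg h0, zero_mul]
    simp_rw [h1]
    rw [lintegral_indicator measurableSet_Icc, ← lintegral_const_mul _ (by fun_prop), yuleFun,
      if_pos hu, ← integral_yule, intervalIntegral.integral_of_le hu, ← integral_Icc_eq_integral_Ioc,
      ofReal_integral_eq_lintegral_ofReal]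
    · congr 1 with s
      rw [← ENNReal.ofReal_mul (by positivity)]
    · exact Continuous.integrableOn_Icc (by fun_prop)
    · filter_upwards [ae_restrict_mem measurableSet_Icc] with s hs
      have := one_sub_exp_neg_nonneg hβ.le hs.1
      simp only [Pi.zero_apply]
      positivity
  · have h1 : ∀ s, yuleFun β j m s * yuleFun β (j + m + 1) 0 (u - s) = 0 := by
      intro s
      by_cases h0 : 0 ≤ s
      · simp [yuleFun, show ¬ s ≤ u by intro h; exact hu (h0.trans h)]
      · simp [yuleFun, h0]
    simp_rw [h1]
    simp [yuleFun, hu]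

theorem expMeasure_eq_withDensity_yuleFun {β : ℝ} (hβ : 0 < β) (j : ℕ) :
    expMeasure (β * (j + 1))
      = volume.withDensity (fun u => ENNReal.ofReal (β * (j + 1)) * yuleFun β j 0 u) := by
  rw [expMeasure, gammaMeasure]
  congr 1
  ext u
  have := exponentialPDF_eq (β * (j + 1)) u
  rw [exponentialPDF, exponentialPDFReal] at this
  rw [gammaPDF, this, yuleFun]
  split_ifs
  · rw [pow_zero, mul_one, ← ENNReal.ofReal_mul (by positivity)]
  · simp

/-- The condition `0 ≤ v` makes both sides vanish for negative `v`; with `v = u - S` it encodes that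
the birth at `S` happened by time `u`. -/
theorem expMeasure_tail {β : ℝ} (hβ : 0 < β) (j : ℕ) (v : ℝ) :
    expMeasure (β * (j + 1)) {x | 0 ≤ v ∧ v < x} = yuleFun β j 0 v := by
  have hr : 0 < β * (j + 1) := by positivity
  have := isProbabilityMeasure_expMeasure hr
  by_cases hv : 0 ≤ v
  · have e : {x | 0 ≤ v ∧ v < x} = (Iic v)ᶜ := by ext x; simp [hv]
    rw [e, prob_compl_eq_one_sub measurableSet_Iic, ← ofReal_cdf, cdf_expMeasure_eq hr, if_pos hv,
      yuleFun, if_pos hv, pow_zero, mul_one, ← ENNReal.ofReal_one, ← ENNReal.ofReal_sub]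
    · simp
    · exact one_sub_exp_neg_nonneg hr.le hv
  · simp [yuleFun, hv]

theorem creationTime_succ {Ω : Type*} {E : ℕ → Ω → ℝ} (m : ℕ) (ω : Ω) :
    creationTime E (m + 1) ω = creationTime E m ω + E m ω :=
  Finset.sum_range_succ _ _

theorem creationTime_add {Ω : Type*} {E : ℕ → Ω → ℝ} (j m : ℕ) (ω : Ω) :
    creationTime E (j + m) ω = creationTime E j ω + creationTime (fun i => E (j + i)) m ω :=
  Finset.sum_range_add _ _ _

theorem measurable_creationTime {Ω : Type*} [MeasurableSpace Ω] {E : ℕ → Ω → ℝ}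
    (hE : ∀ k, Measurable (E k)) (m : ℕ) : Measurable (creationTime E m) :=
  Finset.measurable_fun_sum _ fun i _ => hE i

theorem indepFun_creationTime {Ω : Type*} [MeasurableSpace Ω] {P : Measure Ω} {E : ℕ → Ω → ℝ}
    (hE : ∀ k, Measurable (E k)) (hi : iIndepFun E P) (m : ℕ) :
    IndepFun (creationTime E m) (E m) P := by
  have := hi.indepFun_finsetSum_of_notMem hE (s := Finset.range m) (i := m) (by simp)
  convert! this using 1
  ext ω
  simp [creationTime]

section holding

variable {Ω : Type*} [MeasurableSpace Ω] {P : Measure Ω} [IsProbabilityMeasure P]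
  {E : ℕ → Ω → ℝ} {β : ℝ} {j : ℕ}

/-- The law of the birth time of the new individual number `m + 1` in a Yule process with `j + 1`
initial individuals. -/
theorem map_creationTime_succ (hβ : 0 < β) (hE : ∀ k, Measurable (E k))
    (hl : ∀ k : ℕ, HasLaw (E k) (expMeasure (β * ((j + k : ℕ) + 1))) P) (hi : iIndepFun E P)
    (m : ℕ) :
    P.map (creationTime E (m + 1)) = volume.withDensity (fun u =>
      ENNReal.ofReal ((m + 1) * (j + m + 1).choose (m + 1) * β) * yuleFun β j m u) := by
  induction m with
  | zero =>
    have : creationTime E (0 + 1) = E 0 := by ext ω; simp [creationTime]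
    rw [this, (hl 0).map_eq, expMeasure_eq_withDensity_yuleFun hβ]
    congr 1; ext u
    simp [mul_comm]
  | succ m ih =>
    have hs : creationTime E (m + 1 + 1) = creationTime E (m + 1) + E (m + 1) := by
      ext ω; exact creationTime_succ _ _
    have hmy := measurable_yuleFun β
    rw [hs, (indepFun_creationTime hE hi (m + 1)).map_add_eq_map_conv_map
      (measurable_creationTime hE _) (hE _), ih, (hl _).map_eq,
      expMeasure_eq_withDensity_yuleFun hβ, conv_withDensity_eq_lconvolution
      ((hmy _ _).const_mul _) ((hmy _ _).const_mul _)]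
    congr 1; ext u
    rw [lconvolution_def]
    have h1 : ∀ s, ENNReal.ofReal ((m + 1) * (j + m + 1).choose (m + 1) * β) * yuleFun β j m s
        * (ENNReal.ofReal (β * ((j + (m + 1) : ℕ) + 1)) * yuleFun β (j + (m + 1)) 0 (-s + u))
        = ENNReal.ofReal ((m + 1) * (j + m + 1).choose (m + 1) * β)
          * ENNReal.ofReal (β * ((j + (m + 1) : ℕ) + 1))
          * (yuleFun β j m s * yuleFun β (j + m + 1) 0 (u - s)) := by
      intro s
      rw [neg_add_eq_sub, add_assoc j m 1]
      ring
    have hm1 : Measurable fun s => yuleFun β j m s * yuleFun β (j + m + 1) 0 (u - s) :=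
      (hmy _ _).mul (measurable_yuleFun_sub _ _ _ _)
    simp_rw [h1]
    rw [lintegral_const_mul _ hm1, ← lintegral_yuleFun_mul hβ, ← mul_assoc,
      ← ENNReal.ofReal_mul (by positivity), ← ENNReal.ofReal_mul (by positivity)]
    congr 2
    have := Nat.add_one_mul_choose_eq (j + m + 1) (m + 1)
    have h2 : ((j + m + 1 : ℕ) + 1 : ℝ) * (j + m + 1).choose (m + 1)
        = (j + (m + 1) + 1).choose (m + 1 + 1) * (m + 1 + 1) := by exact_mod_cast this
    push_cast at h2 ⊢
    linear_combination (β * (m + 1) * β) * h2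

/-- The law of the number of new individuals at time `u` in a Yule process with `j + 1` initial
individuals. -/
theorem measure_creationTime_le_lt (hβ : 0 < β) (hE : ∀ k, Measurable (E k))
    (hl : ∀ k : ℕ, HasLaw (E k) (expMeasure (β * ((j + k : ℕ) + 1))) P) (hi : iIndepFun E P)
    (m : ℕ) (u : ℝ) :
    P {ω | creationTime E m ω ≤ u ∧ u < creationTime E (m + 1) ω}
      = (j + m).choose m * yuleFun β j m u := by
  have hmy := measurable_yuleFun β
  have hmS := measurable_creationTime hE
  -- Condition on the birth time: the next holding time is independent of it and must exceed `u -
  -- s`.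
  have h1 : P {ω | creationTime E m ω ≤ u ∧ u < creationTime E (m + 1) ω}
      = ∫⁻ s, yuleFun β (j + m) 0 (u - s) ∂(P.map (creationTime E m)) := by
    have hB : MeasurableSet {x : ℝ × ℝ | x.1 ≤ u ∧ u < x.1 + x.2} :=
      (measurableSet_le measurable_fst measurable_const).inter
        (measurableSet_lt measurable_const (measurable_fst.add measurable_snd))
    have h2 := (indepFun_iff_map_prod_eq_prod_map_map (hmS m).aemeasurable
      (hE m).aemeasurable).1 (indepFun_creationTime hE hi m)
    have h3 : {ω | creationTime E m ω ≤ u ∧ u < creationTime E (m + 1) ω}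
        = (fun ω => (creationTime E m ω, E m ω)) ⁻¹' {x : ℝ × ℝ | x.1 ≤ u ∧ u < x.1 + x.2} := by
      ext ω; simp [creationTime_succ]
    rw [h3, ← Measure.map_apply ((hmS m).prodMk (hE m)) hB, h2, Measure.prod_apply hB]
    congr 1; ext s
    rw [← expMeasure_tail hβ, (hl m).map_eq]
    congr 1; ext x
    simp [sub_lt_iff_lt_add']
  rw [h1]
  cases m with
  | zero =>
    -- Time `0` is an atom, so the density formula for birth times does not cover this case.
    have : creationTime E 0 = fun _ => 0 := by ext ω; simp [creationTime]
    rw [this, Measure.map_const, measure_univ, one_smul, lintegral_dirac' _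
      (measurable_yuleFun_sub _ _ _ _)]
    simp
  | succ m =>
    have hm1 : Measurable fun s => yuleFun β j m s * yuleFun β (j + m + 1) 0 (u - s) :=
      (hmy _ _).mul (measurable_yuleFun_sub _ _ _ _)
    rw [map_creationTime_succ hβ hE hl hi,
      lintegral_withDensity_eq_lintegral_mul _ ((hmy _ _).const_mul _)
      (measurable_yuleFun_sub _ _ _ _)]
    simp only [Pi.mul_apply, mul_assoc]
    rw [← add_assoc, lintegral_const_mul _ hm1, ← lintegral_yuleFun_mul hβ,
      ← mul_assoc (((j + m + 1).choose (m + 1) : ℕ) : ENNReal)]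
    congr 1
    rw [← ENNReal.ofReal_natCast, ← ENNReal.ofReal_mul (by positivity)]
    congr 1
    ring

end holding

/-! ### Ages of the pages given their number. -/

/-- Here `s` is a creation time and `v` the age. Since `1 - e^(-β(s+v)) = (1 - e^(-βs)) e^(-βv) + (1
- e^(-βv))`, the sum is a binomial expansion, using `(i+1) C(K+1,i+1) = (K+1) C(K,i)`. Apart from
the age density, the result depends only on `s + v`, the observation time. -/
theorem sum_yuleFun_mul {β : ℝ} (hβ : 0 < β) (K : ℕ) (s v : ℝ) :
    ∑ i ∈ Finset.range (K + 1),
      (ENNReal.ofReal ((i + 1) * (0 + i + 1).choose (i + 1) * β) * yuleFun β 0 i s)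
        * ((i + 1 + (K - i)).choose (K - i) * yuleFun β (i + 1) (K - i) v)
      = if 0 ≤ s ∧ 0 ≤ v then ENNReal.ofReal ((K + 1) * Real.exp (-(β * (s + v)))
        * (1 - Real.exp (-(β * (s + v)))) ^ K) * ENNReal.ofReal (β * Real.exp (-(β * v)))
        else 0 := by
  by_cases hs : 0 ≤ s
  swap; · simp [hs, yuleFun]
  by_cases hv : 0 ≤ v
  swap; · simp [hv, yuleFun]
  have hs' := one_sub_exp_neg_nonneg hβ.le hs
  have hv' := one_sub_exp_neg_nonneg hβ.le hv
  have hsv' := one_sub_exp_neg_nonneg hβ.le (add_nonneg hs hv)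
  simp only [yuleFun, hs, hv, and_self, if_true]
  rw [← ENNReal.ofReal_mul (by positivity)]
  simp_rw [← ENNReal.ofReal_natCast]
  rw [Finset.sum_congr rfl fun i _ => by
    rw [← ENNReal.ofReal_mul (by positivity), ← ENNReal.ofReal_mul (by positivity),
      ← ENNReal.ofReal_mul (by positivity)]]
  rw [← ENNReal.ofReal_sum_of_nonneg (fun i _ => by positivity)]
  congr 1
  have hb : 1 - Real.exp (-(β * (s + v)))
      = (1 - Real.exp (-(β * s))) * Real.exp (-(β * v)) + (1 - Real.exp (-(β * v))) := by
    rw [mul_add, neg_add, Real.exp_add]; ring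
  rw [hb, add_pow, Finset.mul_sum, Finset.sum_mul]
  refine Finset.sum_congr rfl fun i hi => ?_
  have hiK : i ≤ K := Nat.lt_succ_iff.1 (Finset.mem_range.1 hi)
  have h1 : (i + 1 + (K - i)).choose (K - i) = (K + 1).choose (i + 1) := by
    rw [show i + 1 + (K - i) = K + 1 by omega]
    rw [← Nat.choose_symm (show i + 1 ≤ K + 1 by omega)]
    congr 1; omega
  have h2 : ((K : ℝ) + 1) * K.choose i = (K + 1).choose (i + 1) * (i + 1) := by
    exact_mod_cast Nat.add_one_mul_choose_eq K i
  have h3 : Real.exp (-(β * (s + v))) * Real.exp (-(β * v)) ^ i * Real.exp (-(β * v))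
      = Real.exp (-(β * ((0 : ℕ) + 1) * s)) * Real.exp (-(β * ((i + 1 : ℕ) + 1) * v)) := by
    rw [← Real.exp_nat_mul, ← Real.exp_add, ← Real.exp_add, ← Real.exp_add]
    congr 1; push_cast; ring
  rw [h1, zero_add, Nat.choose_self, mul_pow]
  set a := 1 - Real.exp (-(β * s))
  set b := 1 - Real.exp (-(β * v))
  push_cast
  push_cast at h3
  linear_combination (-(a ^ i * b ^ (K - i) * β * (Real.exp (-(β * (s + v))) *
    Real.exp (-(β * v)) ^ i * Real.exp (-(β * v))))) * h2
    - (a ^ i * b ^ (K - i) * β * (K + 1).choose (i + 1) * (i + 1)) * h3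

/-- The event that exactly `k` webpages are created in `(0,t]`. -/
def newPagesEvent {Ω : Type*} (E : ℕ → Ω → ℝ) (t : ℝ) (k : ℕ) : Set Ω :=
  {ω | creationTime E k ω ≤ t ∧ t < creationTime E (k + 1) ω}

theorem measurableSet_newPagesEvent {Ω : Type*} [MeasurableSpace Ω] {E : ℕ → Ω → ℝ}
    (hE : ∀ k, Measurable (E k)) (t : ℝ) (k : ℕ) : MeasurableSet (newPagesEvent E t k) :=
  (measurableSet_le (measurable_creationTime hE _) measurable_const).inter
    (measurableSet_lt measurable_const (measurable_creationTime hE _))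

theorem indepFun_creationTime_shift {Ω : Type*} [MeasurableSpace Ω] {P : Measure Ω}
    {E : ℕ → Ω → ℝ} (hE : ∀ k, Measurable (E k)) (hi : iIndepFun E P) (j m : ℕ) :
    IndepFun (creationTime E j) (fun ω => (creationTime (fun i => E (j + i)) m ω,
      creationTime (fun i => E (j + i)) (m + 1) ω)) P := by
  let S := Finset.range j
  let T := Finset.Ico j (j + m + 1)
  have hST : Disjoint S T := by
    rw [Finset.disjoint_left]
    intro a ha hb
    simp only [S, T, Finset.mem_range, Finset.mem_Ico] at ha hb
    omega
  let φ : (S → ℝ) → ℝ := fun a => ∑ i, a i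
  -- The default `0` is never reached for `l ≤ m + 1`, the only values needed.
  let ψ : ℕ → (T → ℝ) → ℝ := fun l b =>
    ∑ i ∈ Finset.range l, if h : j + i ∈ T then b ⟨j + i, h⟩ else 0
  have hφ : Measurable φ := Finset.measurable_fun_sum _ fun i _ => measurable_pi_apply i
  have hψ : ∀ l, Measurable (ψ l) := fun l => Finset.measurable_fun_sum _ fun i _ => by
    by_cases h : j + i ∈ T
    · simpa only [h, dif_pos] using measurable_pi_apply _
    · simp [h]
  have hψE : ∀ l, l ≤ m + 1 → ∀ ω, ψ l (fun i => E i ω)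
      = creationTime (fun i => E (j + i)) l ω := by
    intro l hl ω
    refine Finset.sum_congr rfl fun i hi => ?_
    have : j + i ∈ T := by
      have := Finset.mem_range.1 hi
      simp only [T, Finset.mem_Ico]; omega
    rw [dif_pos this]
  have h := (hi.indepFun_finset S T hST hE).comp hφ ((hψ m).prodMk (hψ (m + 1)))
  convert! h using 1
  · ext ω
    exact (Finset.sum_coe_sort S fun i => E i ω).symm
  · ext ω
    · exact (hψE m (by omega) ω).symm
    · exact (hψE (m + 1) le_rfl ω).symm

section yule

variable {Ω : Type*} [MeasurableSpace Ω] {P : Measure Ω} [IsProbabilityMeasure P]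
  {E : ℕ → Ω → ℝ} {β : ℝ}

theorem measure_newPagesEvent (hβ : 0 < β) (hE : ∀ k, Measurable (E k))
    (hl : ∀ k : ℕ, HasLaw (E k) (expMeasure (β * (k + 1))) P) (hi : iIndepFun E P)
    {t : ℝ} (ht : 0 ≤ t) (k : ℕ) :
    P (newPagesEvent E t k)
      = ENNReal.ofReal (Real.exp (-(β * t)) * (1 - Real.exp (-(β * t))) ^ k) := by
  have h := measure_creationTime_le_lt (j := 0) hβ hE (by simpa using hl) hi k t
  rw [newPagesEvent, h]
  simp [yuleFun, ht]

/-- The process restarts at creation number `j + 1`: from then on there are `j + 2` pages, the later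
holding times are independent of the past, and `m` births must occur in the remaining time. -/
theorem lintegral_newPagesEvent (hβ : 0 < β) (hE : ∀ k, Measurable (E k))
    (hl : ∀ k : ℕ, HasLaw (E k) (expMeasure (β * (k + 1))) P) (hi : iIndepFun E P)
    (t : ℝ) (j m : ℕ) {g : ℝ → ENNReal} (hg : Measurable g) :
    ∫⁻ ω in newPagesEvent E t (j + 1 + m), g (t - creationTime E (j + 1) ω) ∂P
      = ∫⁻ s, (ENNReal.ofReal ((j + 1) * (0 + j + 1).choose (j + 1) * β) * yuleFun β 0 j s)
        * ((j + 1 + m).choose m * yuleFun β (j + 1) m (t - s)) * g (t - s) := by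
  let E' : ℕ → Ω → ℝ := fun i => E (j + 1 + i)
  let T : Ω → ℝ × ℝ := fun ω => (creationTime E' m ω, creationTime E' (m + 1) ω)
  have hmS := measurable_creationTime hE (j + 1)
  have hmE' : ∀ k, Measurable (E' k) := fun k => hE _
  have hmT : Measurable T :=
    (measurable_creationTime hmE' m).prodMk (measurable_creationTime hmE' (m + 1))
  have hind := (indepFun_iff_map_prod_eq_prod_map_map hmS.aemeasurable hmT.aemeasurable).1
    (indepFun_creationTime_shift hE hi (j + 1) m)
  let B : Set (ℝ × ℝ × ℝ) := {x | x.2.1 ≤ t - x.1 ∧ t - x.1 < x.2.2}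
  have hB : MeasurableSet B :=
    (measurableSet_le measurable_snd.fst (measurable_fst.const_sub t)).inter
      (measurableSet_lt (measurable_fst.const_sub t) measurable_snd.snd)
  have hgm : Measurable fun s => g (t - s) := hg.comp (by fun_prop)
  have hF : Measurable (B.indicator fun x => g (t - x.1)) :=
    (hgm.comp measurable_fst).indicator hB
  have h1 : ∫⁻ ω in newPagesEvent E t (j + 1 + m), g (t - creationTime E (j + 1) ω) ∂P
      = ∫⁻ x, B.indicator (fun x => g (t - x.1)) x
        ∂(P.map fun ω => (creationTime E (j + 1) ω, T ω)) := by
    rw [lintegral_map hF (hmS.prodMk hmT), ← lintegral_indicator (measurableSet_newPagesEvent hE _ _)]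
    congr 1; ext ω
    have : ω ∈ newPagesEvent E t (j + 1 + m) ↔ (creationTime E (j + 1) ω, T ω) ∈ B := by
      simp only [newPagesEvent, B, T, mem_ofPred_eq]
      rw [creationTime_add (j + 1), add_assoc (j + 1) m 1, creationTime_add (j + 1),
        le_sub_iff_add_le', sub_lt_iff_lt_add']
    by_cases h : ω ∈ newPagesEvent E t (j + 1 + m)
    · rw [indicator_of_mem h, indicator_of_mem (this.1 h)]
    · rw [indicator_of_notMem h, indicator_of_notMem (fun h' => h (this.2 h'))]
  have h2 : ∀ s, ∫⁻ y, B.indicator (fun x => g (t - x.1)) (s, y) ∂(P.map T)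
      = ((j + 1 + m).choose m * yuleFun β (j + 1) m (t - s)) * g (t - s) := by
    intro s
    have hBs : MeasurableSet {y : ℝ × ℝ | y.1 ≤ t - s ∧ t - s < y.2} :=
      (measurableSet_le measurable_fst measurable_const).inter
        (measurableSet_lt measurable_const measurable_snd)
    have e : ∀ y : ℝ × ℝ, B.indicator (fun x => g (t - x.1)) (s, y)
        = {y : ℝ × ℝ | y.1 ≤ t - s ∧ t - s < y.2}.indicator (fun _ => g (t - s)) y := fun y => rfl
    simp_rw [e]
    rw [lintegral_indicator_const hBs, Measure.map_apply hmT hBs, mul_comm,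
      ← measure_creationTime_le_lt (E := E') (P := P) hβ hmE' (fun k => by
        have := hl (j + 1 + k); exact this) (hi.precomp (add_right_injective (j + 1))) m (t - s)]
    rfl
  rw [h1, hind, lintegral_prod _ hF.aemeasurable]
  simp_rw [h2]
  have hmy := measurable_yuleFun β
  have hm3 : Measurable fun s =>
      (j + 1 + m).choose m * yuleFun β (j + 1) m (t - s) * g (t - s) :=
    ((measurable_yuleFun_sub _ _ _ _).const_mul _).mul hgm
  rw [map_creationTime_succ (j := 0) hβ hE (by simpa using hl) hi,
    lintegral_withDensity_eq_lintegral_mul _ ((hmy _ _).const_mul _) hm3]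
  simp only [Pi.mul_apply, mul_assoc, zero_add]

/-- The creation times of the webpages of a Yule process, given their number, are distributed as
an independent sample of truncated exponential variables. -/
theorem sum_lintegral_newPagesEvent (hβ : 0 < β) (hE : ∀ k, Measurable (E k))
    (hl : ∀ k : ℕ, HasLaw (E k) (expMeasure (β * (k + 1))) P) (hi : iIndepFun E P)
    (t : ℝ) (K : ℕ) {g : ℝ → ENNReal} (hg : Measurable g) :
    ∑ i ∈ Finset.range (K + 1),
      ∫⁻ ω in newPagesEvent E t (K + 1), g (t - creationTime E (i + 1) ω) ∂P
      = ENNReal.ofReal ((K + 1) * Real.exp (-(β * t)) * (1 - Real.exp (-(β * t))) ^ K)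
        * ∫⁻ y in Ioc 0 t, ENNReal.ofReal (β * Real.exp (-(β * y))) * g y := by
  have hmy := measurable_yuleFun β
  have hgm : Measurable fun s => g (t - s) := hg.comp (by fun_prop)
  have h1 : ∀ i ∈ Finset.range (K + 1),
      ∫⁻ ω in newPagesEvent E t (K + 1), g (t - creationTime E (i + 1) ω) ∂P
      = ∫⁻ s, (ENNReal.ofReal ((i + 1) * (0 + i + 1).choose (i + 1) * β) * yuleFun β 0 i s)
        * ((i + 1 + (K - i)).choose (K - i) * yuleFun β (i + 1) (K - i) (t - s)) * g (t - s) := by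
    intro i hi'
    have hiK : i ≤ K := Nat.lt_succ_iff.1 (Finset.mem_range.1 hi')
    rw [← lintegral_newPagesEvent hβ hE hl hi t i (K - i) hg,
      show i + 1 + (K - i) = K + 1 by omega]
  have hm2 : ∀ i : ℕ, Measurable fun s =>
      (ENNReal.ofReal ((i + 1) * (0 + i + 1).choose (i + 1) * β) * yuleFun β 0 i s)
        * ((i + 1 + (K - i)).choose (K - i) * yuleFun β (i + 1) (K - i) (t - s)) * g (t - s) :=
    fun i => (((hmy _ _).const_mul _).mul ((measurable_yuleFun_sub _ _ _ _).const_mul _)).mul hgm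
  rw [Finset.sum_congr rfl h1, ← lintegral_finsetSum _ fun i _ => hm2 i]
  simp_rw [← Finset.sum_mul, sum_yuleFun_mul hβ]
  have h2 : ∀ s, (if 0 ≤ s ∧ 0 ≤ t - s then ENNReal.ofReal ((K + 1) *
      Real.exp (-(β * (s + (t - s)))) * (1 - Real.exp (-(β * (s + (t - s))))) ^ K)
      * ENNReal.ofReal (β * Real.exp (-(β * (t - s)))) else 0) * g (t - s)
      = (fun y => (Icc 0 t).indicator (fun y => ENNReal.ofReal ((K + 1) * Real.exp (-(β * t)) *
        (1 - Real.exp (-(β * t))) ^ K) * (ENNReal.ofReal (β * Real.exp (-(β * y))) * g y)) y)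
        (t - s) := by
    intro s
    have : (0 ≤ s ∧ 0 ≤ t - s) ↔ t - s ∈ Icc 0 t := by
      rw [mem_Icc, sub_le_self_iff, and_comm]
    by_cases h : 0 ≤ s ∧ 0 ≤ t - s
    · rw [if_pos h]
      simp only [indicator_of_mem (this.1 h), add_sub_cancel, mul_assoc]
    · rw [if_neg h]
      simp only [indicator_of_notMem (fun h' => h (this.2 h')), zero_mul]
  simp_rw [h2]
  -- The reflection `s ↦ t - s` turns creation times into ages.
  rw [lintegral_sub_left_eq_self, lintegral_indicator measurableSet_Icc,
    lintegral_const_mul _ (by fun_prop), restrict_Ioc_eq_restrict_Icc]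

end yule

/-! ### Evaluation at random times, uniform choice and the count of pages. -/

/-- A point of the grid of mesh `1 / (m + 1)` to the right of `τ`. -/
noncomputable def gridRight (m : ℕ) (τ : ℝ≥0) : ℝ≥0 := (⌊(m + 1) * τ⌋₊ + 1) / (m + 1)

theorem tendsto_gridRight (τ : ℝ≥0) :
    Tendsto (fun m => gridRight m τ) atTop (𝓝[Ici τ] τ) := by
  have hle : ∀ m, τ ≤ gridRight m τ := fun m => by
    rw [gridRight, le_div_iff₀ (by positivity), mul_comm]
    exact (Nat.lt_floor_add_one _).le
  refine tendsto_nhdsWithin_iff.2 ⟨?_, Eventually.of_forall hle⟩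
  have h2 : Tendsto (fun m : ℕ => τ + 1 / ((m : ℝ≥0) + 1)) atTop (𝓝 (τ + 0)) :=
    tendsto_const_nhds.add tendsto_one_div_add_atTop_nhds_zero_nat
  rw [add_zero] at h2
  refine tendsto_of_tendsto_of_tendsto_of_le_of_le tendsto_const_nhds h2 hle fun m => ?_
  have h3 := Nat.floor_le (zero_le : 0 ≤ ((m : ℝ≥0) + 1) * τ)
  have h4 : (0 : ℝ≥0) < m + 1 := by positivity
  simp only [gridRight]
  rw [div_le_iff₀ h4, add_mul τ, one_div, inv_mul_cancel₀ h4.ne', mul_comm τ]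
  gcongr

theorem eventually_gridRight_eq_iff {x : ℝ≥0 → ℕ} {τ : ℝ≥0}
    (hx : ContinuousWithinAt x (Ici τ) τ) (n : ℕ) :
    (∀ᶠ m in atTop, x (gridRight m τ) = n) ↔ x τ = n := by
  have h1 : Tendsto (fun m => x (gridRight m τ)) atTop (𝓝 (x τ)) :=
    hx.tendsto.comp (tendsto_gridRight τ)
  rw [nhds_discrete, tendsto_pure] at h1
  constructor
  · intro h
    obtain ⟨m, h2, h3⟩ := (h1.and h).exists
    exact h2.symm.trans h3
  · rintro rfl
    exact h1

/-- Evaluating a path at a random time is not measurable for the product σ-algebra on all paths. The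
grid event uses countably many coordinates and, for right-continuous integer-valued paths, coincides
with `x τ = n`. -/
theorem measurableSet_eventually_gridRight (n : ℕ) :
    MeasurableSet {p : ℝ≥0 × (ℝ≥0 → ℕ) | ∀ᶠ m in atTop, p.2 (gridRight m p.1) = n} := by
  have h : ∀ m, Measurable fun p : ℝ≥0 × (ℝ≥0 → ℕ) => p.2 (gridRight m p.1) := by
    intro m
    have h1 : Measurable fun q : ℕ × (ℝ≥0 → ℕ) => q.2 ((q.1 + 1) / (m + 1)) :=
      measurable_from_prod_countable_right fun i =>
        measurable_pi_apply (((i : ℝ≥0) + 1) / (m + 1))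
    exact h1.comp ((Nat.measurable_floor.comp (measurable_fst.const_mul _)).prodMk measurable_snd)
  simp only [eventually_atTop]
  have e : {p : ℝ≥0 × (ℝ≥0 → ℕ) | ∃ a, ∀ b ≥ a, p.2 (gridRight b p.1) = n}
      = ⋃ a, ⋂ b, ⋂ (_ : b ≥ a), {p | p.2 (gridRight b p.1) = n} := by
    ext p; simp
  rw [e]
  exact MeasurableSet.iUnion fun a => MeasurableSet.iInter fun b => MeasurableSet.iInter fun _ =>
    h b (measurableSet_singleton n)

theorem measure_floor_mul_eq {Ω : Type*} [MeasurableSpace Ω] {P : Measure Ω}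
    {U : Ω → ℝ} (hUm : Measurable U) (hU : pdf.IsUniform U (Icc (0 : ℝ) 1) P volume) {k i : ℕ}
    (hi : i < k) : P {ω | ⌊U ω * k⌋₊ = i} = (k : ENNReal)⁻¹ := by
  have hk : (0 : ℝ) < k := by exact_mod_cast (Nat.zero_le i).trans_lt hi
  have hU' : P.map U = volume.restrict (Icc 0 1) := by
    rw [hU, ProbabilityTheory.cond]; simp
  have hms : MeasurableSet {x : ℝ | ⌊x * k⌋₊ = i} :=
    (Nat.measurable_floor.comp (measurable_id.mul_const _)) (measurableSet_singleton i)
  have e : {ω | ⌊U ω * k⌋₊ = i} = U ⁻¹' {x : ℝ | ⌊x * k⌋₊ = i} := rfl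
  rw [e, ← Measure.map_apply hUm hms, hU', Measure.restrict_apply hms]
  have h1 : ({x : ℝ | ⌊x * k⌋₊ = i} ∩ Icc 0 1 : Set ℝ) = Ico (i / k : ℝ) ((i + 1) / k) := by
    ext x
    simp only [mem_inter_iff, mem_ofPred_eq, mem_Icc, mem_Ico, div_le_iff₀ hk, lt_div_iff₀ hk]
    constructor
    · rintro ⟨h1, h2, h3⟩
      exact (Nat.floor_eq_iff (by positivity)).1 h1
    · rintro ⟨h1, h2⟩
      have h0 : 0 ≤ x := by
        have : (0 : ℝ) ≤ x * k := le_trans (by positivity) h1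
        exact nonneg_of_mul_nonneg_left this hk
      refine ⟨(Nat.floor_eq_iff (by positivity)).2 ⟨h1, h2⟩, h0, ?_⟩
      have : (i : ℝ) + 1 ≤ k := by exact_mod_cast hi
      nlinarith
  rw [h1, Real.volume_Ico, ← sub_div, add_sub_cancel_left, one_div,
    ENNReal.ofReal_inv_of_pos hk, ENNReal.ofReal_natCast]

/-- At `U = 1` the floor would select an index just beyond the last page. -/
theorem ae_choice_lt_one {Ω : Type*} [MeasurableSpace Ω] {P : Measure Ω}
    {U : Ω → ℝ} (hUm : Measurable U) (hU : pdf.IsUniform U (Icc (0 : ℝ) 1) P volume) :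
    ∀ᵐ ω ∂P, U ω < 1 := by
  have hU' : P.map U = volume.restrict (Icc 0 1) := by
    rw [hU, ProbabilityTheory.cond]; simp
  have h1 : ∀ᵐ x ∂(P.map U), x < 1 := by
    rw [hU', ← restrict_Ico_eq_restrict_Icc]
    filter_upwards [ae_restrict_mem measurableSet_Ico] with x hx using hx.2
  exact ae_of_ae_map hUm.aemeasurable h1

theorem ae_holding_nonneg {Ω : Type*} [MeasurableSpace Ω] {P : Measure Ω} {E : ℕ → Ω → ℝ} {β : ℝ}
    (hE : ∀ k, Measurable (E k)) (hβ : 0 < β)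
    (hl : ∀ k : ℕ, HasLaw (E k) (expMeasure (β * (k + 1))) P) : ∀ᵐ ω ∂P, ∀ k, 0 ≤ E k ω := by
  rw [ae_all_iff]
  intro k
  have h1 : ∀ᵐ x ∂(P.map (E k)), 0 ≤ x := by
    rw [(hl k).map_eq, expMeasure_eq_withDensity_yuleFun hβ,
      ae_withDensity_iff ((measurable_yuleFun _ _ _).const_mul _)]
    filter_upwards with x hx
    by_contra h
    exact hx (by simp [yuleFun, h])
  exact ae_of_ae_map (hE k).aemeasurable h1

/-- Nonnegative holding times make creation times monotone, so the pages counted are exactly `1, …,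
k`. -/
theorem numNewPages_eq {Ω : Type*} {E : ℕ → Ω → ℝ} {ω : Ω} (hω : ∀ k, 0 ≤ E k ω) {t : ℝ} {k : ℕ}
    (hk : ω ∈ newPagesEvent E t k) : numNewPages E t ω = k := by
  have hmono : Monotone fun j => creationTime E j ω :=
    monotone_nat_of_le_succ fun j => by rw [creationTime_succ]; linarith [hω j]
  have h1 : {j : ℕ | 1 ≤ j ∧ creationTime E j ω ≤ t} = (Finset.Icc 1 k : Finset ℕ) := by
    ext j
    simp only [mem_ofPred_eq, Finset.coe_Icc, mem_Icc, and_congr_right_iff]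
    intro _
    constructor
    · intro h
      by_contra hj
      exact absurd (hk.2.trans_le (hmono (by omega : k + 1 ≤ j))) h.not_gt
    · intro h
      exact (hmono h).trans hk.1
  rw [numNewPages, h1, Set.ncard_coe_finset]
  simp

section yule

variable {Ω : Type*} [MeasurableSpace Ω] {P : Measure Ω} [IsProbabilityMeasure P]
  {E : ℕ → Ω → ℝ} {β : ℝ}

theorem hasSum_exp_mul_pow (hβ : 0 < β) {t : ℝ} (ht : 0 ≤ t) :
    HasSum (fun k : ℕ => Real.exp (-(β * t)) * (1 - Real.exp (-(β * t))) ^ k) 1 := by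
  have h := (hasSum_geometric_of_lt_one (one_sub_exp_neg_nonneg hβ.le ht)
    (sub_lt_self 1 (Real.exp_pos _))).mul_left (Real.exp (-(β * t)))
  rwa [sub_sub_cancel, mul_inv_cancel₀ (Real.exp_pos _).ne'] at h

theorem tsum_ofReal_exp_mul_pow (hβ : 0 < β) {t : ℝ} (ht : 0 ≤ t) :
    ∑' k : ℕ, ENNReal.ofReal (Real.exp (-(β * t)) * (1 - Real.exp (-(β * t))) ^ k) = 1 := by
  have h := hasSum_exp_mul_pow hβ ht
  have h0 := one_sub_exp_neg_nonneg hβ.le ht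
  rw [← ENNReal.ofReal_tsum_of_nonneg (fun k => by positivity) h.summable, h.tsum_eq,
    ENNReal.ofReal_one]

/-- Almost surely finitely many webpages are created in finite time. -/
theorem measure_eq_tsum_newPagesEvent (hβ : 0 < β) (hE : ∀ k, Measurable (E k))
    (hl : ∀ k : ℕ, HasLaw (E k) (expMeasure (β * (k + 1))) P) (hi : iIndepFun E P)
    {t : ℝ} (ht : 0 ≤ t) (C : Set Ω) : P C = ∑' k, P (C ∩ newPagesEvent E t k) := by
  have hm := measurableSet_newPagesEvent hE t
  -- Disjointness holds only almost surely, as holding times may be negative on a null set.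
  have hd : Pairwise (Function.onFun (AEDisjoint P) (newPagesEvent E t)) := by
    intro k l hkl
    rw [Function.onFun, AEDisjoint, ← compl_compl (_ ∩ _), ← mem_ae_iff]
    filter_upwards [ae_holding_nonneg hE hβ hl] with ω hω h
    exact hkl ((numNewPages_eq hω h.1).symm.trans (numNewPages_eq hω h.2))
  have h1 : P (⋃ k, newPagesEvent E t k) = 1 := by
    rw [measure_iUnion₀ hd fun k => (hm k).nullMeasurableSet]
    simp_rw [measure_newPagesEvent hβ hE hl hi ht]
    exact tsum_ofReal_exp_mul_pow hβ ht
  -- Working with restricted measures allows an arbitrary, possibly non-measurable, `C`.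
  have h2 : P.restrict (⋃ k, newPagesEvent E t k) = P := by
    rw [Measure.restrict_eq_self_of_ae_mem]
    exact (prob_compl_eq_zero_iff (MeasurableSet.iUnion hm)).2 h1
  conv_lhs => rw [← h2, Measure.restrict_iUnion_ae hd fun k => (hm k).nullMeasurableSet,
    Measure.sum_apply_of_countable]
  simp_rw [Measure.restrict_apply' (hm _)]

end yule

/-- As `ncard` of an infinite set is `0`, the event says that the set of new pages is finite and
nonempty, both countable conditions. -/
theorem measurableSet_one_le_numNewPages {Ω : Type*} [MeasurableSpace Ω] {E : ℕ → Ω → ℝ}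
    (hE : ∀ k, Measurable (E k)) (t : ℝ) : MeasurableSet {ω | 1 ≤ numNewPages E t ω} := by
  have e : {ω | 1 ≤ numNewPages E t ω} =
      (⋃ N, ⋂ j, ⋂ (_ : N < j), {ω | t < creationTime E j ω}) ∩
        ⋃ j, ⋃ (_ : 1 ≤ j), {ω | creationTime E j ω ≤ t} := by
    ext ω
    simp only [mem_inter_iff, mem_iUnion, mem_iInter, mem_ofPred_eq, exists_prop]
    have h1 : 1 ≤ numNewPages E t ω ↔ {j : ℕ | 1 ≤ j ∧ creationTime E j ω ≤ t}.Finite ∧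
        {j : ℕ | 1 ≤ j ∧ creationTime E j ω ≤ t}.Nonempty := by
      constructor
      · intro h
        have hf := Set.finite_of_ncard_pos h
        exact ⟨hf, (Set.ncard_pos hf).1 h⟩
      · rintro ⟨hf, hne⟩
        exact (Set.ncard_pos hf).2 hne
    rw [h1]
    refine and_congr ?_ Iff.rfl
    rw [Set.finite_iff_bddAbove]
    constructor
    · rintro ⟨N, hN⟩
      refine ⟨N, fun j hj => ?_⟩
      by_contra h
      exact absurd (hN ⟨by omega, not_lt.1 h⟩) (by omega)
    · rintro ⟨N, hN⟩
      refine ⟨N, fun j hj => ?_⟩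
      by_contra h
      exact absurd (hN j (not_le.1 h)) (not_lt.2 hj.2)
  have hm := measurable_creationTime hE
  rw [e]
  exact (MeasurableSet.iUnion fun N => MeasurableSet.iInter fun j => MeasurableSet.iInter fun _ =>
    measurableSet_lt measurable_const (hm j)).inter
    (MeasurableSet.iUnion fun j => MeasurableSet.iUnion fun _ =>
      measurableSet_le (hm j) measurable_const)

/-! ### Links of a randomly chosen page. -/

namespace IsGeneralizedYuleModel

variable {Ω : Type*} [MeasurableSpace Ω] {P : Measure Ω}
  {β ν : ℝ} {lam : ℕ → ℝ} {E : ℕ → Ω → ℝ} {X : ℕ → ℝ≥0 → Ω → ℕ} {U : Ω → ℝ}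

theorem measure_links_eq (hM : IsGeneralizedYuleModel β ν lam P E X U) (j n : ℕ) (τ : ℝ≥0) :
    P {ω | X j τ ω = n} = P {ω | X 0 τ ω = n} :=
  (hM.links_copies j).measure_mem_eq (s := {x | x τ = n})
    (measurableSet_eq_fun (measurable_pi_apply τ) measurable_const)

variable [IsProbabilityMeasure P]

/-- The number of in-links of a given webpage, jointly with the number of webpages and the
choice. -/
theorem measure_choice_inter_linksAt (hM : IsGeneralizedYuleModel β ν lam P E X U) (t : ℝ)
    (k j n : ℕ) {V : Set ℝ} (hV : MeasurableSet V) :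
    P (U ⁻¹' V ∩ ({ω | linksAt E X t j ω = n} ∩ newPagesEvent E t k))
      = P (U ⁻¹' V) * ∫⁻ ω in newPagesEvent E t k,
        ENNReal.ofReal (stateProb P (X 0) n (t - creationTime E j ω)) ∂P := by
  let e : ℕ → (ℕ → ℝ) → ℝ := fun k y => y k
  have he : ∀ k, Measurable (e k) := fun k => measurable_pi_apply k
  let Y : Ω → (ℕ → ℝ) := fun ω k => E k ω
  let Z : Ω → (ℕ → ℝ≥0 → ℕ) := fun ω j s => X j s ω
  have hY : Measurable Y := measurable_pi_lambda _ hM.measurable_holding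
  have hZ : Measurable Z := measurable_pi_lambda _ fun j => measurable_pi_lambda _ fun s =>
    (hM.links j).measurable s
  let B : Set ((ℕ → ℝ) × (ℕ → ℝ≥0 → ℕ)) := {p | (∀ᶠ m in atTop,
    p.2 j (gridRight m (t - creationTime e j p.1).toNNReal) = n) ∧ p.1 ∈ newPagesEvent e t k}
  have hB : MeasurableSet B := by
    have h1 : Measurable fun p : (ℕ → ℝ) × (ℕ → ℝ≥0 → ℕ) =>
        ((t - creationTime e j p.1).toNNReal, p.2 j) :=
      (((measurable_creationTime he j).comp measurable_fst).const_sub t).real_toNNReal.prodMk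
        ((measurable_pi_apply j).comp measurable_snd)
    exact (h1 (measurableSet_eventually_gridRight n)).inter
      (measurable_fst (measurableSet_newPagesEvent he t k))
  have hset : {ω | linksAt E X t j ω = n} ∩ newPagesEvent E t k
      = (fun ω => (Y ω, Z ω)) ⁻¹' B := by
    ext ω
    refine and_congr ?_ Iff.rfl
    exact (eventually_gridRight_eq_iff ((hM.links j).right_continuous ω _) n).symm
  rw [hset, hM.choice_indep.measure_inter_preimage_eq_mul _ _ hV hB]
  congr 1
  -- With `U` split off, Fubini freezes the holding times, and the links are then read at a
  -- deterministic time.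
  have hind := (indepFun_iff_map_prod_eq_prod_map_map hY.aemeasurable hZ.aemeasurable).1
    hM.links_indep_holding
  rw [← Measure.map_apply (hY.prodMk hZ) hB, hind, Measure.prod_apply hB,
    lintegral_map (measurable_measure_prodMk_left hB) hY,
    ← lintegral_indicator (measurableSet_newPagesEvent hM.measurable_holding t k)]
  congr 1; ext ω
  rw [Measure.map_apply hZ (measurable_prodMk_left hB)]
  by_cases hω : ω ∈ newPagesEvent E t k
  · rw [indicator_of_mem hω, ofReal_stateProb, ← hM.measure_links_eq j]
    congr 1; ext ω'
    refine (and_iff_left (show Y ω ∈ newPagesEvent e t k from hω)).trans ?_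
    exact eventually_gridRight_eq_iff ((hM.links j).right_continuous ω' _) n
  · rw [indicator_of_notMem hω]
    have : Z ⁻¹' (Prod.mk (Y ω) ⁻¹' B) = ∅ := by
      ext ω'
      exact iff_of_false (fun h => hω h.2) (fun h => h)
    rw [this, measure_empty]

end IsGeneralizedYuleModel

namespace IsGeneralizedYuleModel

variable {Ω : Type*} [MeasurableSpace Ω] {P : Measure Ω}
  {β ν : ℝ} {lam : ℕ → ℝ} {E : ℕ → Ω → ℝ} {X : ℕ → ℝ≥0 → Ω → ℕ} {U : Ω → ℝ}

theorem ae_numNewPages_eq (hM : IsGeneralizedYuleModel β ν lam P E X U) (hβ : 0 < β) (t : ℝ) :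
    ∀ᵐ ω ∂P, ∀ k, ω ∈ newPagesEvent E t k → numNewPages E t ω = k := by
  filter_upwards [ae_holding_nonneg hM.measurable_holding hβ hM.holding_law] with ω hω k hk
  exact numNewPages_eq hω hk

variable [IsProbabilityMeasure P]

/-- The number of in-links of a webpage chosen uniformly among the webpages
`d, …, d + k - 1`. -/
theorem measure_linksAt_floor (hM : IsGeneralizedYuleModel β ν lam P E X U) (t : ℝ)
    (k d l n : ℕ) (hk : 0 < k) :
    P ({ω | linksAt E X t (⌊U ω * k⌋₊ + d) ω = n} ∩ newPagesEvent E t l)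
      = (k : ENNReal)⁻¹ * ∑ i ∈ Finset.range k, ∫⁻ ω in newPagesEvent E t l,
        ENNReal.ofReal (stateProb P (X 0) n (t - creationTime E (i + d) ω)) ∂P := by
  set C := {ω | linksAt E X t (⌊U ω * k⌋₊ + d) ω = n} ∩ newPagesEvent E t l
  have hV : ∀ i : ℕ, MeasurableSet {x : ℝ | ⌊x * k⌋₊ = i} := fun i =>
    (Nat.measurable_floor.comp (measurable_id.mul_const _)) (measurableSet_singleton i)
  have hUm := hM.measurable_choice
  have hf : Measurable fun ω => ⌊U ω * k⌋₊ := Nat.measurable_floor.comp (hUm.mul_const _)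
  have hfi : ∀ i, MeasurableSet ((fun ω => ⌊U ω * k⌋₊) ⁻¹' {i}) :=
    fun i => hf (measurableSet_singleton i)
  have h1 : P C = ∑' i : ℕ, P ((fun ω => ⌊U ω * k⌋₊) ⁻¹' {i} ∩ C) := by
    have h := tsum_measure_preimage_singleton (μ := P.restrict C) (s := univ)
      (f := fun ω => ⌊U ω * k⌋₊) countable_univ (fun i _ => hfi i)
    rw [preimage_univ, Measure.restrict_apply_univ] at h
    rw [← h, tsum_univ (fun i => P.restrict C ((fun ω => ⌊U ω * k⌋₊) ⁻¹' {i}))]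
    simp_rw [Measure.restrict_apply (hfi _)]
  rw [h1, tsum_eq_sum (s := Finset.range k), Finset.mul_sum]
  · refine Finset.sum_congr rfl fun i hi => ?_
    have hik := Finset.mem_range.1 hi
    rw [← measure_floor_mul_eq hUm hM.choice_law hik]
    have h2 := hM.measure_choice_inter_linksAt t l (i + d) n (hV i)
    rw [preimage_ofPred_eq] at h2
    rw [← h2]
    congr 1; ext ω
    simp only [C, mem_inter_iff, mem_preimage, mem_singleton_iff, mem_ofPred_eq]
    refine and_congr_right fun h => ?_
    rw [h]
  · intro i hi
    have hik : k ≤ i := not_lt.1 fun h => hi (Finset.mem_range.2 h)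
    rw [← compl_compl (_ ∩ _), ← mem_ae_iff]
    filter_upwards [ae_choice_lt_one hUm hM.choice_law] with ω hω h
    have hk0 : (0 : ℝ) < k := by exact_mod_cast hk
    have h3 : ⌊U ω * k⌋₊ = i := h.1
    have h4 : ⌊U ω * k⌋₊ < k := by
      rw [Nat.floor_lt' hk.ne']
      nlinarith
    omega

theorem measure_newPagesEvent_eq (hM : IsGeneralizedYuleModel β ν lam P E X U) (hβ : 0 < β)
    {t : ℝ} (ht : 0 ≤ t) (k : ℕ) :
    P (newPagesEvent E t k)
      = ENNReal.ofReal (Real.exp (-(β * t)) * (1 - Real.exp (-(β * t))) ^ k) :=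
  measure_newPagesEvent hβ hM.measurable_holding hM.holding_law hM.holding_indep ht k

theorem sum_lintegral_stateProb (hM : IsGeneralizedYuleModel β ν lam P E X U) (hβ : 0 < β)
    {t : ℝ} (n K : ℕ) :
    ∑ i ∈ Finset.range (K + 1), ∫⁻ ω in newPagesEvent E t (K + 1),
      ENNReal.ofReal (stateProb P (X 0) n (t - creationTime E (i + 1) ω)) ∂P
      = ENNReal.ofReal ((K + 1) * Real.exp (-(β * t)) * (1 - Real.exp (-(β * t))) ^ K)
        * ENNReal.ofReal (β * ∫ y in Ioc 0 t, Real.exp (-(β * y)) * stateProb P (X 0) n y) := by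
  rw [sum_lintegral_newPagesEvent hβ hM.measurable_holding hM.holding_law hM.holding_indep t K
    (g := fun y => ENNReal.ofReal (stateProb P (X 0) n y))
    ((hM.links 0).continuous_stateProb n).measurable.ennreal_ofReal,
    (hM.links 0).lintegral_exp_mul_stateProb hβ n Ioc_subset_Ioi_self]

/-- The `1 / (K + 1)` of the uniform choice cancels the factor `K + 1` of the sum over pages. The
exponent is `K` rather than `K + 1` because the second factor is the unnormalised age integral,
which absorbs one `1 - e^(-βt)`. -/
theorem measure_randomPageLinks_inter (hM : IsGeneralizedYuleModel β ν lam P E X U) (hβ : 0 < β)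
    {t : ℝ} (n K : ℕ) :
    P ({ω | randomPageLinks E X U t ω = n} ∩ newPagesEvent E t (K + 1))
      = ENNReal.ofReal (Real.exp (-(β * t)) * (1 - Real.exp (-(β * t))) ^ K)
        * ENNReal.ofReal (β * ∫ y in Ioc 0 t, Real.exp (-(β * y)) * stateProb P (X 0) n y) := by
  have h1 : P ({ω | randomPageLinks E X U t ω = n} ∩ newPagesEvent E t (K + 1))
      = P ({ω | linksAt E X t (⌊U ω * (K + 1 : ℕ)⌋₊ + 1) ω = n} ∩ newPagesEvent E t (K + 1)) := by
    apply measure_congr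
    filter_upwards [hM.ae_numNewPages_eq hβ t] with ω hω
    refine propext (and_congr_left fun h => ?_)
    change randomPageLinks E X U t ω = n ↔ _
    rw [randomPageLinks, hω _ h]
    rfl
  rw [h1, hM.measure_linksAt_floor t (K + 1) 1 (K + 1) n K.succ_pos,
    hM.sum_lintegral_stateProb hβ, ← mul_assoc, mul_assoc (K + 1 : ℝ),
    ENNReal.ofReal_mul (by positivity), ← mul_assoc]
  have h2 : ENNReal.ofReal ((K : ℝ) + 1) = ((K + 1 : ℕ) : ENNReal) := by
    rw [← ENNReal.ofReal_natCast]; push_cast; rfl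
  rw [h2, ENNReal.inv_mul_cancel (by simp) (ENNReal.natCast_ne_top _), one_mul]

theorem measure_eq_tsum (hM : IsGeneralizedYuleModel β ν lam P E X U) (hβ : 0 < β)
    {t : ℝ} (ht : 0 ≤ t) (C : Set Ω) : P C = P (C ∩ newPagesEvent E t 0)
      + ∑' K, P (C ∩ newPagesEvent E t (K + 1)) := by
  rw [measure_eq_tsum_newPagesEvent hβ hM.measurable_holding hM.holding_law hM.holding_indep ht C,
    tsum_eq_zero_add' ENNReal.summable]

theorem measure_one_le_numNewPages_inter (hM : IsGeneralizedYuleModel β ν lam P E X U)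
    (hβ : 0 < β) {t : ℝ} (ht : 0 ≤ t) (C : Set Ω) :
    P ({ω | 1 ≤ numNewPages E t ω} ∩ C) = ∑' K, P (C ∩ newPagesEvent E t (K + 1)) := by
  have h0 : P ({ω | 1 ≤ numNewPages E t ω} ∩ C ∩ newPagesEvent E t 0) = 0 := by
    rw [← compl_compl (_ ∩ newPagesEvent E t 0), ← mem_ae_iff]
    filter_upwards [hM.ae_numNewPages_eq hβ t] with ω hω h
    have h1 : 1 ≤ numNewPages E t ω := h.1.1
    rw [hω 0 h.2] at h1
    omega
  rw [hM.measure_eq_tsum hβ ht, h0, zero_add]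
  congr 1; ext K
  apply measure_congr
  filter_upwards [hM.ae_numNewPages_eq hβ t] with ω hω
  refine propext (and_congr_left fun h => ?_)
  refine and_iff_right (?_ : 1 ≤ numNewPages E t ω)
  rw [hω _ h]; omega

theorem measure_one_le_numNewPages (hM : IsGeneralizedYuleModel β ν lam P E X U)
    (hβ : 0 < β) {t : ℝ} (ht : 0 ≤ t) :
    P {ω | 1 ≤ numNewPages E t ω} = ENNReal.ofReal (1 - Real.exp (-(β * t))) := by
  have h := hM.measure_one_le_numNewPages_inter hβ ht univ
  have h0 := one_sub_exp_neg_nonneg hβ.le ht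
  have h1 : ∀ K : ℕ, P (newPagesEvent E t (K + 1)) = ENNReal.ofReal (1 - Real.exp (-(β * t)))
      * ENNReal.ofReal (Real.exp (-(β * t)) * (1 - Real.exp (-(β * t))) ^ K) := fun K => by
    rw [hM.measure_newPagesEvent_eq hβ ht, ← ENNReal.ofReal_mul h0]
    ring_nf
  simp_rw [inter_univ, univ_inter, h1] at h
  rw [h, ENNReal.tsum_mul_left, tsum_ofReal_exp_mul_pow hβ ht, mul_one]

theorem measure_one_le_numNewPages_inter_links (hM : IsGeneralizedYuleModel β ν lam P E X U)
    (hβ : 0 < β) {t : ℝ} (ht : 0 ≤ t) (n : ℕ) :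
    P ({ω | 1 ≤ numNewPages E t ω} ∩ {ω | randomPageLinks E X U t ω = n})
      = ENNReal.ofReal (β * ∫ y in Ioc 0 t, Real.exp (-(β * y)) * stateProb P (X 0) n y) := by
  rw [hM.measure_one_le_numNewPages_inter hβ ht]
  simp_rw [hM.measure_randomPageLinks_inter hβ]
  rw [ENNReal.tsum_mul_right, tsum_ofReal_exp_mul_pow hβ ht, one_mul]

theorem randomPageProb_eq (hM : IsGeneralizedYuleModel β ν lam P E X U)
    (hβ : 0 < β) {t : ℝ} (ht : 0 < t) (n : ℕ) :
    randomPageProb P E X U t n = β / (1 - Real.exp (-(β * t)))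
      * ∫ y in (0 : ℝ)..t, Real.exp (-(β * y)) * stateProb P (X 0) n y := by
  rw [randomPageProb, measureReal_def,
    cond_apply (measurableSet_one_le_numNewPages hM.measurable_holding t),
    hM.measure_one_le_numNewPages hβ ht.le, hM.measure_one_le_numNewPages_inter_links hβ ht.le,
    ENNReal.toReal_mul, ENNReal.toReal_inv,
    ENNReal.toReal_ofReal (one_sub_exp_neg_nonneg hβ.le ht.le),
    ENNReal.toReal_ofReal (mul_integral_stateProb_nonneg hβ n _), intervalIntegral.integral_of_le ht.le]
  ring

/-- The chance that the initial webpage is chosen. -/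
theorem hasSum_exp_mul_pow_div (hβ : 0 < β) {t : ℝ} (ht : 0 < t) :
    HasSum (fun k : ℕ => Real.exp (-(β * t)) * (1 - Real.exp (-(β * t))) ^ k / (k + 1))
      (Real.exp (-(β * t)) * (β * t) / (1 - Real.exp (-(β * t)))) := by
  have h0 : 0 < 1 - Real.exp (-(β * t)) := by
    have : 0 < β * t := by positivity
    simp [this]
  -- The series `∑ x^(k+1) / (k+1) = -log (1 - x)` at `x = 1 - e^(-βt)` equals `βt`.
  have h1 := Real.hasSum_pow_div_log_of_abs_lt_one (x := 1 - Real.exp (-(β * t))) (by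
    rw [abs_of_pos h0]
    exact sub_lt_self 1 (Real.exp_pos _))
  rw [sub_sub_cancel, Real.log_exp, neg_neg] at h1
  have h2 := h1.mul_left (Real.exp (-(β * t)) / (1 - Real.exp (-(β * t))))
  convert! h2 using 1
  · ext k
    rw [pow_succ]
    field_simp
  · ring

theorem measure_randomAnyPageLinks_inter (hM : IsGeneralizedYuleModel β ν lam P E X U)
    (hβ : 0 < β) {t : ℝ} (n l : ℕ) :
    P ({ω | randomAnyPageLinks E X U t ω = n} ∩ newPagesEvent E t l)
      = ((l + 1 : ℕ) : ENNReal)⁻¹ * (∑ i ∈ Finset.range l, ∫⁻ ω in newPagesEvent E t l,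
          ENNReal.ofReal (stateProb P (X 0) n (t - creationTime E (i + 1) ω)) ∂P
        + ∫⁻ ω in newPagesEvent E t l,
          ENNReal.ofReal (stateProb P (X 0) n (t - creationTime E 0 ω)) ∂P) := by
  rw [← Finset.sum_range_succ' (fun i => ∫⁻ ω in newPagesEvent E t l,
    ENNReal.ofReal (stateProb P (X 0) n (t - creationTime E i ω)) ∂P)]
  have h := hM.measure_linksAt_floor t (l + 1) 0 l n l.succ_pos
  simp only [add_zero] at h
  rw [← h]
  apply measure_congr
  filter_upwards [hM.ae_numNewPages_eq hβ t] with ω hω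
  refine propext (and_congr_left fun h => ?_)
  change randomAnyPageLinks E X U t ω = n ↔ _
  rw [randomAnyPageLinks, hω _ h, ← Nat.cast_add_one]
  rfl

theorem lintegral_stateProb_le (n l : ℕ) (t : ℝ) (f : Ω → ℝ) :
    ∫⁻ ω in newPagesEvent E t l, ENNReal.ofReal (stateProb P (X 0) n (f ω)) ∂P
      ≤ P (newPagesEvent E t l) := by
  refine (lintegral_mono (g := fun _ => 1) fun ω => ?_).trans (by simp)
  simpa using stateProb_le_one (P := P) (X := X 0) n (f ω)

/-- Including the initial webpage changes the distribution of the number of in-links by at most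
twice the chance that the initial webpage is chosen. -/
theorem abs_measureReal_randomAnyPageLinks_sub_le (hM : IsGeneralizedYuleModel β ν lam P E X U)
    (hβ : 0 < β) {t : ℝ} (ht : 0 < t) (n : ℕ) :
    |P.real {ω | randomAnyPageLinks E X U t ω = n}
        - β * ∫ y in (0 : ℝ)..t, Real.exp (-(β * y)) * stateProb P (X 0) n y|
      ≤ Real.exp (-(β * t)) * (β * t) / (1 - Real.exp (-(β * t))) := by
  have h0 := one_sub_exp_neg_nonneg hβ.le ht.le
  have hJ0 := mul_integral_stateProb_nonneg (P := P) (X := X 0) hβ n (Ioc 0 t)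
  have hI := hM.measure_one_le_numNewPages_inter_links hβ ht.le n
  have hI1 : ENNReal.ofReal
      (β * ∫ y in Ioc 0 t, Real.exp (-(β * y)) * stateProb P (X 0) n y) ≤ 1 := hI ▸ prob_le_one
  rw [intervalIntegral.integral_of_le ht.le]
  set J := β * ∫ y in Ioc 0 t, Real.exp (-(β * y)) * stateProb P (X 0) n y
  set r := 1 - Real.exp (-(β * t))
  set L := Real.exp (-(β * t)) * (β * t) / r
  have hL0 : 0 ≤ L := by positivity
  -- `w k` is the probability that there are `k` new pages and the initial one is chosen.
  let w : ℕ → ENNReal := fun k => ENNReal.ofReal (Real.exp (-(β * t)) * r ^ k / (k + 1))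
  have hw : ∑' k, w k = ENNReal.ofReal L := by
    have h := hasSum_exp_mul_pow_div hβ ht
    rw [← ENNReal.ofReal_tsum_of_nonneg (fun k => by positivity) h.summable, h.tsum_eq]
  have hgeo : ∑' k : ℕ, ENNReal.ofReal (Real.exp (-(β * t)) * r ^ k) = 1 :=
    tsum_ofReal_exp_mul_pow hβ ht.le
  set C := {ω | randomAnyPageLinks E X U t ω = n}
  have hinv : ∀ k : ℕ, ((k + 1 : ℕ) : ENNReal)⁻¹ = ENNReal.ofReal ((k : ℝ) + 1)⁻¹ := by
    intro k
    rw [ENNReal.ofReal_inv_of_pos (by positivity), ← Nat.cast_add_one, ENNReal.ofReal_natCast]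
  have hfirst : ∀ k, ((k + 1 : ℕ) : ENNReal)⁻¹ * ∫⁻ ω in newPagesEvent E t k,
      ENNReal.ofReal (stateProb P (X 0) n (t - creationTime E 0 ω)) ∂P ≤ w k := by
    intro k
    refine (mul_le_mul_right (lintegral_stateProb_le n k t _) _).trans_eq ?_
    rw [hM.measure_newPagesEvent_eq hβ ht.le, hinv, ← ENNReal.ofReal_mul (by positivity)]
    congr 1
    rw [div_eq_inv_mul]
  have hcoef : ∀ K : ℕ, ((K + 1 + 1 : ℕ) : ENNReal)⁻¹
      * ENNReal.ofReal ((K + 1) * Real.exp (-(β * t)) * r ^ K)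
      = ENNReal.ofReal (Real.exp (-(β * t)) * r ^ K * ((K + 1) / (K + 2))) := by
    intro K
    rw [hinv, ← ENNReal.ofReal_mul (by positivity)]
    congr 1
    push_cast
    field_simp
    ring
  have hup : P C ≤ ENNReal.ofReal (L + J) := by
    rw [ENNReal.ofReal_add hL0 hJ0, ← hw, hM.measure_eq_tsum hβ ht.le C,
      tsum_eq_zero_add' (f := w) ENNReal.summable, add_assoc, ← one_mul (ENNReal.ofReal J), ← hgeo,
      ← ENNReal.tsum_mul_right, ← ENNReal.tsum_add]
    refine add_le_add ?_ (ENNReal.tsum_le_tsum fun K => ?_)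
    · have h1 := hfirst 0
      rw [zero_add] at h1
      rwa [hM.measure_randomAnyPageLinks_inter hβ, Finset.range_zero, Finset.sum_empty, zero_add,
        zero_add]
    · rw [hM.measure_randomAnyPageLinks_inter hβ, mul_add, hM.sum_lintegral_stateProb hβ,
        ← mul_assoc, add_comm, hcoef]
      refine add_le_add (hfirst (K + 1)) (mul_le_mul_left (ENNReal.ofReal_le_ofReal ?_) _)
      refine mul_le_of_le_one_right (by positivity) ?_
      rw [div_le_one (by positivity)]
      linarith
  have hlow : ENNReal.ofReal J ≤ P C + ENNReal.ofReal L := by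
    calc ENNReal.ofReal J
        = ∑' K : ℕ, ENNReal.ofReal (Real.exp (-(β * t)) * r ^ K) * ENNReal.ofReal J := by
          rw [ENNReal.tsum_mul_right, hgeo, one_mul]
      _ ≤ ∑' K, (P (C ∩ newPagesEvent E t (K + 1)) + w K) := by
          refine ENNReal.tsum_le_tsum fun K => ?_
          rw [hM.measure_randomAnyPageLinks_inter hβ, mul_add, hM.sum_lintegral_stateProb hβ,
            ← mul_assoc, hcoef]
          -- The mass lost by giving the initial page a share `1 / (K + 2)` is at most `w K`,
          -- because `J ≤ 1`.
          have e : Real.exp (-(β * t)) * r ^ K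
              = Real.exp (-(β * t)) * r ^ K * ((K + 1) / (K + 2))
                + Real.exp (-(β * t)) * r ^ K / (K + 2) := by
            field_simp; ring
          have h1 : ENNReal.ofReal (Real.exp (-(β * t)) * r ^ K / (K + 2)) * ENNReal.ofReal J
              ≤ w K := by
            refine (mul_le_of_le_one_right' hI1).trans (ENNReal.ofReal_le_ofReal ?_)
            gcongr
            norm_num
          conv_lhs => rw [e, ENNReal.ofReal_add (by positivity) (by positivity), add_mul]
          exact add_le_add le_self_add h1
      _ ≤ P C + ENNReal.ofReal L := by
          rw [ENNReal.tsum_add, hw, hM.measure_eq_tsum hβ ht.le C]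
          exact add_le_add le_add_self le_rfl
  have hPC : P C = ENNReal.ofReal (P.real C) := ofReal_measureReal (μ := P) (s := C) |>.symm
  rw [hPC] at hup hlow
  rw [← ENNReal.ofReal_add measureReal_nonneg hL0] at hlow
  rw [ENNReal.ofReal_le_ofReal_iff (by positivity)] at hup
  rw [ENNReal.ofReal_le_ofReal_iff (add_nonneg measureReal_nonneg hL0)] at hlow
  rw [abs_sub_le_iff]
  constructor <;> linarith

end IsGeneralizedYuleModel

/-! ### Passage to the limit. -/

theorem tendsto_exp_neg_mul_atTop {β : ℝ} (hβ : 0 < β) :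
    Tendsto (fun t => 1 - Real.exp (-(β * t))) atTop (𝓝 1) := by
  have h := (Real.tendsto_exp_neg_atTop_nhds_zero.comp
    (tendsto_id.const_mul_atTop hβ)).const_sub 1
  simpa using h

theorem mainTheorem2 {Ω : Type*} [MeasurableSpace Ω] (P : Measure Ω) [IsProbabilityMeasure P]
    (β ν : ℝ) (hβ : 0 < β) (hν0 : 0 < ν) (hν1 : ν < 1)
    (lam : ℕ → ℝ) (hlam : ∀ r, 1 ≤ r → 0 ≤ lam r)
    (E : ℕ → Ω → ℝ) (X : ℕ → ℝ≥0 → Ω → ℕ) (U : Ω → ℝ)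
    (hM : IsGeneralizedYuleModel β ν lam P E X U) :
    (∀ t : ℝ, 0 < t → ∀ n : ℕ, 1 ≤ n →
      randomPageProb P E X U t n
          = β / (1 - Real.exp (-(β * t)))
            * ∫ y in (0 : ℝ)..t, Real.exp (-(β * y)) * stateProb P (X 0) n y ∧
      randomPageProb P E X U t n
          = (1 - Real.exp (-(β * t)))⁻¹
            * (β ^ ν * ((∏ r ∈ Finset.Ico 1 n, lam r) / ∏ r ∈ Finset.Icc 1 n, (β ^ ν + lam r))
              - β * ∫ y in Ioi t, Real.exp (-(β * y)) * stateProb P (X 0) n y)) ∧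
    ∃ q : PMF ℕ,
      (∀ n : ℕ, 1 ≤ n → (q n).toReal
        = β ^ ν * ((∏ r ∈ Finset.Ico 1 n, lam r) / ∏ r ∈ Finset.Icc 1 n, (β ^ ν + lam r))) ∧
      (∀ n : ℕ, Tendsto (fun t => randomPageProb P E X U t n) atTop (𝓝 (q n).toReal)) ∧
      (∀ n : ℕ, Tendsto (fun t => P.real {ω | randomAnyPageLinks E X U t ω = n}) atTop
        (𝓝 (q n).toReal)) := by
  have hint : ∀ n t, 0 < t → β * ∫ y in (0 : ℝ)..t, Real.exp (-(β * y)) * stateProb P (X 0) n y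
      = β * (∫ y in Ioi (0 : ℝ), Real.exp (-(β * y)) * stateProb P (X 0) n y)
        - β * ∫ y in Ioi t, Real.exp (-(β * y)) * stateProb P (X 0) n y := by
    intro n t ht
    have h1 := (hM.links 0).integrableOn_exp_mul_stateProb hβ n
    rw [← intervalIntegral.integral_interval_add_Ioi h1 (h1.mono_set (Ioi_subset_Ioi ht.le))]
    ring
  have hJ : ∀ n, Tendsto (fun t => β * ∫ y in (0 : ℝ)..t,
      Real.exp (-(β * y)) * stateProb P (X 0) n y) atTop
      (𝓝 (β * ∫ y in Ioi (0 : ℝ), Real.exp (-(β * y)) * stateProb P (X 0) n y)) := fun n =>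
    (intervalIntegral_tendsto_integral_Ioi 0
      ((hM.links 0).integrableOn_exp_mul_stateProb hβ n) tendsto_id).const_mul β
  have hr := tendsto_exp_neg_mul_atTop hβ
  refine ⟨fun t ht n hn => ⟨hM.randomPageProb_eq hβ ht n, ?_⟩, ?_⟩
  · rw [hM.randomPageProb_eq hβ ht n, ← (hM.links 0).laplace_stateProb hν0 hν1 hβ hlam hn,
      ← hint n t ht]
    ring
  -- On `ℕ`, pointwise convergence to a probability mass function is convergence in distribution;
  -- being a `PMF` also records that the limits sum to `1`.
  · obtain ⟨q, hq⟩ := (hM.links 0).exists_pmf_laplace hβ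
    refine ⟨q, fun n hn => ?_, fun n => ?_, fun n => ?_⟩
    · rw [hq, (hM.links 0).laplace_stateProb hν0 hν1 hβ hlam hn]
    · rw [hq]
      have h := (hJ n).div hr one_ne_zero
      rw [div_one] at h
      refine h.congr' ?_
      filter_upwards [eventually_gt_atTop 0] with t ht
      rw [hM.randomPageProb_eq hβ ht n, Pi.div_apply]
      ring
    · rw [hq]
      have h1 : Tendsto (fun t => Real.exp (-(β * t)) * (β * t) / (1 - Real.exp (-(β * t))))
          atTop (𝓝 0) := by
        have h2 := ((Real.tendsto_pow_mul_exp_neg_atTop_nhds_zero 1).comp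
          (tendsto_id.const_mul_atTop hβ)).div hr one_ne_zero
        rw [zero_div] at h2
        refine h2.congr fun t => ?_
        simp [mul_comm]
      have h3 : Tendsto (fun t => P.real {ω | randomAnyPageLinks E X U t ω = n}
          - β * ∫ y in (0 : ℝ)..t, Real.exp (-(β * y)) * stateProb P (X 0) n y) atTop (𝓝 0) := by
        refine squeeze_zero_norm' ?_ h1
        filter_upwards [eventually_gt_atTop 0] with t ht
        exact hM.abs_measureReal_randomAnyPageLinks_sub_le hβ ht n
      simpa using h3.add (hJ n)
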